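/- Let $\eta_1,\eta_2>0$ and $0<\eta_3<1$. Let $\Lambda_m$ denote the Lebesgue constant of univariate polynomial interpolation of degree $m$ in the $m+1$ Čebyšev points $\cos\frac{(2i+1)\pi}{2(m+1)}$, $0\le i\le m$, of $[-1,1]$, and put $$\widehat\beta:=\min\Big\{1,\Big(\sqrt{\tfrac32}-1\Big)\frac{2}{\eta_2},\frac{2(1-\eta_3)}{\eta_2^2(2\sqrt6+5)}\Big\},\qquad \rho_0:=1+\widehat\beta,\qquad \alpha:=\frac{\sqrt{\widehat\beta^2+1}+\widehat\beta}{\widehat\beta+1},$$ $$C_1:=e^{\eta_1}\sup_{m\ge0}\frac{8(\Lambda_m+1)}{(\rho_0-1)\alpha^{m/2}},\qquad C_0:=\sup_{m\ge0}\,6\,\frac{\Lambda_m^5}{\alpha^{m/2}}\,C_1,\qquad \sigma:=\frac{1-\eta_3}{2}.$$ Then $\rho_0>1$, the suprema $C_1$ and $C_0$ are finite, and the following holds. Let $\zeta\in\mathbb C$ with $\operatorname{Re}\zeta>0$, let $c\in\mathbb R^3$, and let $B_t,B_s\subset\mathbb R^3$ be closed axis-parallel boxes (the bounding boxes of the clusters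 $t$, $s$) with barycenters $M_t,M_s$. With $q:=\max\{\operatorname{diam}B_t,\operatorname{diam}B_s\}$ and $D:=\operatorname{dist}(B_t,B_s)$, suppose that the block $(t,s)$ is admissible, i.e. $$\text{(a)}\ \ |\operatorname{Im}\zeta|\,\Big\|\frac{M_t-M_s}{\|M_t-M_s\|}-c\Big\|\le\frac{\eta_1}{q},\qquad \text{(b)}\ \ q\le\eta_2D,\qquad \text{(c)}\ \ |\operatorname{Im}\zeta|\,q^2\le\max\{\eta_2,\eta_3(\operatorname{Re}\zeta)D\}\,D .$$ For $z\in\mathbb R^3\setminus\{0\}$ let $$G(\zeta,z)=\frac{e^{-\zeta\|z\|}}{4\pi\|z\|}=e^{-i(\operatorname{Im}\zeta)\langle z,c\rangle}G_c(\zeta,z),\qquad G_c(\zeta,z)=e^{-(\operatorname{Re}\zeta)\|z\|}\,\frac{e^{-i(\operatorname{Im}\zeta)(\|z\|-\langle z,c\rangle)}}{4\pi\|z\|}.$$ For $m\in\mathbb N_0$ let $\mathfrak I$ be the tensor Čebyšev interpolation of degree $m$ in each of the six variables on $B_t\times B_s$ (interpolation in the affine images of the tensor Čebyšev points), applied to $(x,y)\mapsto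 G_c(\zeta,x-y)$, and set $\widetilde G_{t,s}(x,y):=e^{-i(\operatorname{Im}\zeta)\langle x-y,c\rangle}\,\mathfrak I\big[G_c(\zeta,\cdot-\cdot)\big](x,y)$. Then for every $m\in\mathbb N_0$ $$\sup_{x\in B_t,\,y\in B_s}\big|G(\zeta,x-y)-\widetilde G_{t,s}(x,y)\big|\le\frac{C_0\,e^{-\sigma(\operatorname{Re}\zeta)\operatorname{dist}(B_t,B_s)}}{4\pi\operatorname{dist}(B_t,B_s)}\,\rho_0^{-m}.$$ Here $\rho_0$ depends only on $\eta_2,\eta_3$ and $C_0$ only on $\eta_1,\eta_2,\eta_3$; in particular the bound is uniform in $\operatorname{Im}\zeta$, $c$ and the boxes. -/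

import Mathlib

namespace DirInterp

noncomputable section

/-- Euclidean three-space. -/
abbrev E3 : Type := EuclideanSpace ℝ (Fin 3)

/-- A nonempty closed axis-parallel box in `ℝ³`; flat boxes (some sides of length zero), which
arise as bounding boxes of planar pieces of a surface, are allowed. -/
structure Box where
  lo : E3
  hi : E3
  lo_le_hi : ∀ i, lo i ≤ hi i

namespace Box

/-- The points of the box. -/
def pts (B : Box) : Set E3 := {x | ∀ i, B.lo i ≤ x i ∧ x i ≤ B.hi i}

/-- The barycenter of the box. -/
def center (B : Box) : E3 := (1 / 2 : ℝ) • (B.lo + B.hi)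

/-- The Euclidean diameter of the box. -/
def diam (B : Box) : ℝ := Metric.diam B.pts

/-- The affine map of the reference cube `[-1,1]³` onto the box. -/
def theta (B : Box) (u : E3) : E3 :=
  WithLp.toLp 2 fun i => B.center i + (B.hi i - B.lo i) / 2 * u i

/-- The inverse of `theta`. In a direction in which the box is flat the box has only one coordinate
value and the reference coordinate is `0` (`x / 0 = 0`); still `theta (thetaInv x) = x` on the box. -/
def thetaInv (B : Box) (x : E3) : E3 :=
  WithLp.toLp 2 fun i => (x i - B.center i) / ((B.hi i - B.lo i) / 2)

/-- The distance `inf {‖x - y‖ : x ∈ A, y ∈ B}` of two boxes. -/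
def boxDist (A B : Box) : ℝ := sInf (Set.image2 dist A.pts B.pts)

end Box

/-- The larger of the two diameters. -/
def maxDiam (Bt Bs : Box) : ℝ := max Bt.diam Bs.diam

/-- The three directional admissibility conditions for a pair of boxes, a direction `c` and a
complex frequency `ζ`. The angle condition is written with the denominator
`max (diam Bt) (diam Bs)` cleared. -/
structure Admissible (η₁ η₂ η₃ : ℝ) (ζ : ℂ) (c : E3) (Bt Bs : Box) : Prop where
  angle : |ζ.im| * ‖‖Bt.center - Bs.center‖⁻¹ • (Bt.center - Bs.center) - c‖ * maxDiam Bt Bs ≤ η₁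
  sing : maxDiam Bt Bs ≤ η₂ * Box.boxDist Bt Bs
  para : |ζ.im| * max (Bt.diam ^ 2) (Bs.diam ^ 2) ≤
    max η₂ (η₃ * ζ.re * Box.boxDist Bt Bs) * Box.boxDist Bt Bs

/-- The kernel `G(ζ,z) = exp(-ζ‖z‖) / (4π‖z‖)`. -/
def G (ζ : ℂ) (z : E3) : ℂ :=
  Complex.exp (-ζ * (‖z‖ : ℂ)) / (4 * (Real.pi : ℂ) * (‖z‖ : ℂ))

/-- The plane wave `exp(-i (Im ζ) ⟨z,c⟩)`. -/
def planeWave (ζ : ℂ) (c z : E3) : ℂ :=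
  Complex.exp (-Complex.I * (ζ.im : ℂ) * ((inner ℝ z c : ℝ) : ℂ))

/-- The remainder `G_c(ζ,z) = exp(-(Re ζ)‖z‖) exp(-i (Im ζ) (‖z‖ - ⟨z,c⟩)) / (4π‖z‖)`. -/
def Gc (ζ : ℂ) (c z : E3) : ℂ :=
  Complex.exp (-(ζ.re : ℂ) * (‖z‖ : ℂ)) *
    (Complex.exp (-Complex.I * (ζ.im : ℂ) * ((‖z‖ - inner ℝ z c : ℝ) : ℂ)) /
      (4 * (Real.pi : ℂ) * (‖z‖ : ℂ)))

/-- The `m + 1` Čebyšev points in `(-1,1)`, the zeros of the Čebyšev polynomial of degree `m + 1`. -/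
def chebNode (m : ℕ) (i : Fin (m + 1)) : ℝ :=
  Real.cos ((2 * (i : ℕ) + 1) * Real.pi / (2 * (m + 1)))

/-- The Lagrange polynomials of the Čebyšev points. -/
def chebLagrange (m : ℕ) (i : Fin (m + 1)) : Polynomial ℝ :=
  Lagrange.basis Finset.univ (chebNode m) i

/-- The Lebesgue constant of univariate Čebyšev interpolation on `[-1,1]`. -/
def lebesgueConst (m : ℕ) : ℝ :=
  ⨆ x : Set.Icc (-1 : ℝ) 1, ∑ i, |(chebLagrange m i).eval (x : ℝ)|

/-- The tensor Čebyšev points of the box `B`. -/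
def boxNode (m : ℕ) (B : Box) (μ : Fin 3 → Fin (m + 1)) : E3 :=
  B.theta (WithLp.toLp 2 fun l => chebNode m (μ l))

/-- The tensor Lagrange polynomials of the box `B`. -/
def boxLagrange (m : ℕ) (B : Box) (μ : Fin 3 → Fin (m + 1)) (x : E3) : ℝ :=
  ∏ l, (chebLagrange m (μ l)).eval (B.thetaInv x l)

/-- Tensor Čebyšev interpolation of degree `m` in each of the six variables on `Bt × Bs`. -/
def tensorInterp (m : ℕ) (Bt Bs : Box) (g : E3 → E3 → ℂ) (x y : E3) : ℂ :=
  ∑ μ : Fin 3 → Fin (m + 1), ∑ ν : Fin 3 → Fin (m + 1),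
    g (boxNode m Bt μ) (boxNode m Bs ν) *
      ((boxLagrange m Bt μ x : ℝ) : ℂ) * ((boxLagrange m Bs ν y : ℝ) : ℂ)

/-- The approximate kernel on `Bt × Bs`: the plane wave times the interpolant of the remainder. -/
def Gtilde (ζ : ℂ) (c : E3) (m : ℕ) (Bt Bs : Box) (x y : E3) : ℂ :=
  planeWave ζ c (x - y) * tensorInterp m Bt Bs (fun u v => Gc ζ c (u - v)) x y

def betaHat (η₂ η₃ : ℝ) : ℝ :=
  min 1 (min ((√(3 / 2) - 1) * (2 / η₂)) (2 * (1 - η₃) / (η₂ ^ 2 * (2 * √6 + 5))))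

def rho0 (η₂ η₃ : ℝ) : ℝ := 1 + betaHat η₂ η₃

def alpha (η₂ η₃ : ℝ) : ℝ :=
  (√(betaHat η₂ η₃ ^ 2 + 1) + betaHat η₂ η₃) / (betaHat η₂ η₃ + 1)

/-- The sequence whose supremum, times `exp η₁`, is `C1`. -/
def C1seq (η₂ η₃ : ℝ) (m : ℕ) : ℝ :=
  8 * (lebesgueConst m + 1) / ((rho0 η₂ η₃ - 1) * alpha η₂ η₃ ^ ((m : ℝ) / 2))

def C1 (η₁ η₂ η₃ : ℝ) : ℝ := Real.exp η₁ * ⨆ m : ℕ, C1seq η₂ η₃ m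

/-- The sequence whose supremum is `C0`. -/
def C0seq (η₁ η₂ η₃ : ℝ) (m : ℕ) : ℝ :=
  6 * (lebesgueConst m ^ 5 / alpha η₂ η₃ ^ ((m : ℝ) / 2)) * C1 η₁ η₂ η₃

def C0 (η₁ η₂ η₃ : ℝ) : ℝ := ⨆ m : ℕ, C0seq η₁ η₂ η₃ m

end

end DirInterp

open DirInterp

/-! The plane wave has modulus one, so the error equals the interpolation error of `Gc`. Along a
coordinate line, `Gc` at `z + p w e_j` extends to complex `w` once `‖·‖` is replaced by the root `N`
of `‖z‖² + 2 z_j p w + (p w)²`. Let `D` be the distance of the boxes, `q` the larger diameter and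
`β` the value `betaHat`. If `w` is within `β` of `[-1,1]`, rebasing at a nearby real point leaves a
perturbation `κ` with `|κ| ≤ s = β q / 2 ≤ D / 4`. Hence `Re N ≥ D - s`, and the extension is
holomorphic.

The danger is the growth of the oscillating factor, `exp(Im ζ · Im(N - c_j κ))`. To first order `N`
is `‖z‖ + (z_j/‖z‖) κ`, so the exponent is governed by `z/‖z‖ - c`, plus a remainder quadratic in
`s`. The angle condition bounds the deviation of the central direction from `c`; the parabolic
condition bounds both the quadratic remainder and the turning of `z/‖z‖` across the boxes. The
outcome is a constant plus a part of `Re ζ · D` small enough to leave the decay rate `(1 - η₃)/2`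
(`exponent_le`, `norm_kernelExt_le`).

A function bounded by `M` on the `β`-neighbourhood of `[-1,1]` has Chebyshev coefficients of size `M
ρ^(-|k|)` with `ρ = β + √(β² + 1)`, because the Bernstein ellipse of parameter `ρ` lies in that
neighbourhood. This gives the univariate error `2 M (Λ + 1) / β · ρ^(-m)`
(`norm_sub_chebInterp_le`), and tensorization over six variables costs `1 + Λ + ⋯ + Λ⁵ ≤ 6 Λ⁵`.

Finally `ρ = rho0 · alpha` with `alpha > 1`: one half of the spare factor `alpha^m` absorbs `Λ + 1`
into `C1`, the other absorbs `Λ⁵` into `C0`. The crude bound `Λ ≤ (m + 1)²` makes both suprema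
finite. -/

namespace DirInterp

open Polynomial Polynomial.Chebyshev

/-! ### Chebyshev points and a polynomial bound for the Lebesgue constant. -/

section ChebyshevNodes

theorem chebNode_mem_Icc (m : ℕ) (i : Fin (m + 1)) : chebNode m i ∈ Set.Icc (-1 : ℝ) 1 :=
  Real.cos_mem_Icc _

theorem chebNode_injective (m : ℕ) : Function.Injective (chebNode m) := by
  have hm : (0 : ℝ) < 2 * (m + 1) := by positivity
  have mem : ∀ i : Fin (m + 1),
      (2 * (i : ℕ) + 1) * Real.pi / (2 * (m + 1)) ∈ Set.Icc 0 Real.pi := by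
    intro i
    have hi : ((i : ℕ) : ℝ) ≤ m := by exact_mod_cast Nat.lt_succ_iff.mp i.2
    refine ⟨by positivity, ?_⟩
    rw [div_le_iff₀ hm, mul_comm]
    exact mul_le_mul_of_nonneg_left (by linarith) Real.pi_pos.le
  intro i j hij
  have h := Real.injOn_cos (mem i) (mem j) hij
  rw [div_left_inj' hm.ne', mul_left_inj' Real.pi_ne_zero] at h
  have h' : ((i : ℕ) : ℝ) = (j : ℕ) := by linarith
  exact Fin.ext (by exact_mod_cast h')

theorem eval_T_chebNode (m : ℕ) (i : Fin (m + 1)) :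
    (T ℝ ((m + 1 : ℕ) : ℤ)).eval (chebNode m i) = 0 := by
  rw [chebNode, T_real_cos, Real.cos_eq_zero_iff]
  refine ⟨i, ?_⟩
  push_cast
  field_simp

/-- `T'_{m+1} = (m+1) U_m`, and at a node `U_m(cos θ) sin θ = sin((m+1)θ) = ±1`. -/
theorem abs_eval_derivative_T_chebNode (m : ℕ) (i : Fin (m + 1)) :
    (m : ℝ) + 1 ≤ |(derivative (T ℝ ((m + 1 : ℕ) : ℤ))).eval (chebNode m i)| := by
  set θ : ℝ := (2 * (i : ℕ) + 1) * Real.pi / (2 * (m + 1)) with hθ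
  have hU := U_real_cos θ m
  have hcos : Real.cos (((m : ℤ) + 1) * θ) = 0 := by
    have := eval_T_chebNode m i
    rw [chebNode, T_real_cos] at this
    push_cast at this ⊢
    exact this
  have hsin : |Real.sin (((m : ℤ) + 1) * θ)| = 1 := by
    have := Real.sin_sq_add_cos_sq (((m : ℤ) + 1) * θ)
    rw [hcos] at this
    rw [← sq_eq_sq₀ (abs_nonneg _) zero_le_one, sq_abs]
    linarith
  have h1 : 1 ≤ |(U ℝ m).eval (Real.cos θ)| := by
    have h2 : |(U ℝ m).eval (Real.cos θ)| * |Real.sin θ| = 1 := by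
      rw [← abs_mul, hU, hsin]
    nlinarith [Real.abs_sin_le_one θ, abs_nonneg ((U ℝ m).eval (Real.cos θ))]
  have hd : derivative (T ℝ ((m + 1 : ℕ) : ℤ)) = ((m : ℝ[X]) + 1) * U ℝ m := by
    rw [T_derivative_eq_U]
    push_cast
    simp
  have h3 : (derivative (T ℝ ((m + 1 : ℕ) : ℤ))).eval (chebNode m i)
      = ((m : ℝ) + 1) * (U ℝ m).eval (Real.cos θ) := by
    rw [hd, chebNode]
    simp [hθ]
  rw [h3, abs_mul, abs_of_pos (by positivity : (0 : ℝ) < m + 1)]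
  exact le_mul_of_one_le_right (by positivity) h1

theorem T_eq_C_mul_nodal (m : ℕ) :
    T ℝ ((m + 1 : ℕ) : ℤ) =
      C (T ℝ ((m + 1 : ℕ) : ℤ)).leadingCoeff * Lagrange.nodal Finset.univ (chebNode m) := by
  have hlc : (T ℝ ((m + 1 : ℕ) : ℤ)).leadingCoeff ≠ 0 := by
    rw [leadingCoeff_T]; positivity
  refine Polynomial.eq_of_degree_le_of_eval_index_eq Finset.univ (v := chebNode m)
    (chebNode_injective m).injOn ?_ ?_ ?_ ?_
  · rw [degree_T, Int.natAbs_natCast]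
    simp
  · rw [degree_C_mul hlc, Lagrange.degree_nodal, degree_T, Int.natAbs_natCast]
    simp
  · rw [leadingCoeff_mul, leadingCoeff_C, Lagrange.nodal_monic.leadingCoeff, mul_one]
  · intro i hi
    rw [eval_T_chebNode, eval_mul, Lagrange.eval_nodal_at_node hi, mul_zero]

/-- Mean value inequality from the node, where `T` vanishes; the derivative of `T` on `[-1,1]` is
largest at `1`, with value `(m+1)²`. -/
theorem abs_eval_T_le (m : ℕ) (i : Fin (m + 1)) {x : ℝ} (hx : x ∈ Set.Icc (-1 : ℝ) 1) :
    |(T ℝ ((m + 1 : ℕ) : ℤ)).eval x| ≤ ((m : ℝ) + 1) ^ 2 * |x - chebNode m i| := by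
  have hbound : ∀ y ∈ Set.Icc (-1 : ℝ) 1,
      ‖(derivative (T ℝ ((m + 1 : ℕ) : ℤ))).eval y‖ ≤ ((m : ℝ) + 1) ^ 2 := by
    intro y hy
    have h := abs_iterate_derivative_T_real_le ((m + 1 : ℕ) : ℤ) 1 (abs_le.mpr hy)
    simp only [Function.iterate_one] at h
    refine h.trans (le_of_eq ?_)
    rw [derivative_T_eval_one]
    push_cast
    ring
  have := (convex_Icc (-1 : ℝ) 1).norm_image_sub_le_of_norm_hasDerivWithin_le
    (f := fun y => (T ℝ ((m + 1 : ℕ) : ℤ)).eval y)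
    (fun y _ => (Polynomial.hasDerivAt _ y).hasDerivWithinAt) hbound (chebNode_mem_Icc m i) hx
  simpa only [eval_T_chebNode, sub_zero, Real.norm_eq_abs] using this

/-- The Lagrange polynomial is `T(x) / (T'(x_i) (x - x_i))`: the numerator is at most `(m+1)² |x -
x_i|` and `|T'(x_i)| ≥ m+1`. -/
theorem abs_eval_chebLagrange_le (m : ℕ) (i : Fin (m + 1)) {x : ℝ}
    (hx : x ∈ Set.Icc (-1 : ℝ) 1) : |(chebLagrange m i).eval x| ≤ m + 1 := by
  rcases eq_or_ne x (chebNode m i) with rfl | hxi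
  · rw [chebLagrange, Lagrange.eval_basis_self (chebNode_injective m).injOn (Finset.mem_univ i),
      abs_one]
    linarith [(Nat.cast_nonneg m : (0 : ℝ) ≤ m)]
  rw [chebLagrange, Lagrange.eval_basis_not_at_node (Finset.mem_univ i) hxi,
    Lagrange.nodalWeight_eq_eval_derivative_nodal (Finset.mem_univ i)]
  have hT := T_eq_C_mul_nodal m
  set L := (T ℝ ((m + 1 : ℕ) : ℤ)).leadingCoeff with hL
  have hlc : L ≠ 0 := by
    rw [hL, leadingCoeff_T]; positivity
  have h1 := abs_eval_T_le m i hx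
  have h2 := abs_eval_derivative_T_chebNode m i
  rw [hT] at h1 h2
  simp only [derivative_mul, derivative_C, zero_mul, zero_add, eval_mul, eval_C, abs_mul] at h1 h2
  rw [abs_mul, abs_mul, abs_inv, abs_inv]
  set a := |eval x (Lagrange.nodal Finset.univ (chebNode m))|
  set b := |eval (chebNode m i) (derivative (Lagrange.nodal Finset.univ (chebNode m)))|
  have hL0 : 0 < |L| := abs_pos.mpr hlc
  have hd : 0 < |x - chebNode m i| := abs_pos.mpr (sub_ne_zero.mpr hxi)
  have hm : (0 : ℝ) < m + 1 := by positivity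
  have hb : 0 < b := by
    by_contra hb
    nlinarith
  rw [← mul_inv, ← div_eq_mul_inv, div_le_iff₀ (by positivity)]
  have h3 : |L| * a ≤ |L| * ((m + 1) * (b * |x - chebNode m i|)) := by
    calc |L| * a ≤ (m + 1) * |x - chebNode m i| * (m + 1) := by linarith
      _ ≤ (m + 1) * |x - chebNode m i| * (|L| * b) := by gcongr
      _ = _ := by ring
  exact le_of_mul_le_mul_left h3 hL0

theorem sum_abs_eval_chebLagrange_le_sq (m : ℕ) {x : ℝ} (hx : x ∈ Set.Icc (-1 : ℝ) 1) :
    ∑ i, |(chebLagrange m i).eval x| ≤ ((m : ℝ) + 1) ^ 2 := by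
  calc ∑ i, |(chebLagrange m i).eval x| ≤ ∑ _i : Fin (m + 1), ((m : ℝ) + 1) :=
        Finset.sum_le_sum fun i _ => abs_eval_chebLagrange_le m i hx
    _ = _ := by simp; ring

theorem sum_abs_eval_chebLagrange_le (m : ℕ) {x : ℝ} (hx : x ∈ Set.Icc (-1 : ℝ) 1) :
    ∑ i, |(chebLagrange m i).eval x| ≤ lebesgueConst m := by
  refine le_ciSup (f := fun x : Set.Icc (-1 : ℝ) 1 => ∑ i, |(chebLagrange m i).eval (x : ℝ)|)
    ⟨((m : ℝ) + 1) ^ 2, ?_⟩ ⟨x, hx⟩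
  rintro _ ⟨y, rfl⟩
  exact sum_abs_eval_chebLagrange_le_sq m y.2

theorem lebesgueConst_le (m : ℕ) : lebesgueConst m ≤ ((m : ℝ) + 1) ^ 2 :=
  haveI : Nonempty (Set.Icc (-1 : ℝ) 1) := ⟨⟨0, by norm_num⟩⟩
  ciSup_le fun x => sum_abs_eval_chebLagrange_le_sq m x.2

/-- Polynomials of degree at most `m` are reproduced by interpolation. -/
theorem sum_eval_mul_chebLagrange (m : ℕ) {P : ℝ[X]} (hP : P.degree < ((m + 1 : ℕ) : WithBot ℕ))
    (x : ℝ) : ∑ i, P.eval (chebNode m i) * (chebLagrange m i).eval x = P.eval x := by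
  have h := Lagrange.eq_interpolate (s := Finset.univ) (v := chebNode m) (f := P)
    (chebNode_injective m).injOn (by simpa using hP)
  conv_rhs => rw [h, Lagrange.interpolate_apply, eval_finsetSum]
  simp [chebLagrange]

theorem one_le_lebesgueConst (m : ℕ) : 1 ≤ lebesgueConst m := by
  have h0 : (0 : ℝ) ∈ Set.Icc (-1 : ℝ) 1 := by norm_num
  refine le_trans ?_ (sum_abs_eval_chebLagrange_le m h0)
  have h := sum_eval_mul_chebLagrange m (P := 1) (by
    rw [degree_one]; exact_mod_cast Nat.succ_pos m) 0
  simp only [eval_one, one_mul] at h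
  calc (1 : ℝ) ≤ |∑ i, (chebLagrange m i).eval (0 : ℝ)| := by rw [h, abs_one]
    _ ≤ _ := Finset.abs_sum_le_sum_abs _ _

end ChebyshevNodes

/-! ### Joukowski map and Chebyshev series of holomorphic functions. -/

section ChebyshevExpansion

theorem inv_add_sqrt (β : ℝ) : (β + √(β ^ 2 + 1))⁻¹ = √(β ^ 2 + 1) - β := by
  have h := Real.sq_sqrt (by positivity : (0 : ℝ) ≤ β ^ 2 + 1)
  refine inv_eq_of_mul_eq_one_right ?_
  linarith

/-- The Joukowski map sends the annulus `ρ⁻¹ ≤ |v| ≤ ρ`, `ρ = β + √(β² + 1)`, into the closed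
`β`-neighbourhood of `[-1, 1]`. -/
theorem exists_norm_joukowski_sub_le {β : ℝ} (hβ : 0 ≤ β) {v : ℂ}
    (h1 : (β + √(β ^ 2 + 1))⁻¹ ≤ ‖v‖) (h2 : ‖v‖ ≤ β + √(β ^ 2 + 1)) :
    ∃ t ∈ Set.Icc (-1 : ℝ) 1, ‖(v + v⁻¹) / 2 - (t : ℂ)‖ ≤ β := by
  have hρ : 0 < β + √(β ^ 2 + 1) := by positivity
  have hs : 0 < ‖v‖ := lt_of_lt_of_le (inv_pos.mpr hρ) h1
  set s := ‖v‖ with hsdef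
  set a := (s + s⁻¹) / 2 with ha
  set b := (s - s⁻¹) / 2 with hb
  set c := v.re / s with hc
  set d := v.im / s with hd
  have hss : s * s⁻¹ = 1 := mul_inv_cancel₀ hs.ne'
  -- `a` and `|b|` are the semi-axes of the image ellipse with foci `±1`; on the annulus `|b| ≤ β`.
  have hab : a ^ 2 = b ^ 2 + 1 := by rw [ha, hb]; linear_combination hss
  have ha1 : 1 ≤ a := by
    have : 0 < a := by positivity
    nlinarith [sq_nonneg b]
  have hnorm : s ^ 2 = v.re ^ 2 + v.im ^ 2 := by
    rw [hsdef, Complex.sq_norm, Complex.normSq_apply]; ring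
  have hcd : c ^ 2 + d ^ 2 = 1 := by
    rw [hc, hd, div_pow, div_pow, ← add_div, ← hnorm, div_self (by positivity)]
  have hinv : s⁻¹ ≤ β + √(β ^ 2 + 1) := by
    rw [inv_le_comm₀ hs hρ]; exact h1
  have hinv' : (β + √(β ^ 2 + 1))⁻¹ ≤ s⁻¹ := inv_anti₀ hs h2
  rw [inv_add_sqrt] at h1 hinv'
  have hbβ : b ^ 2 ≤ β ^ 2 := by
    refine sq_le_sq' ?_ ?_ <;> rw [hb] <;> linarith
  have hre : ((v + v⁻¹) / 2).re = a * c := by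
    have : v.re = s * c := by rw [hc]; field_simp
    simp only [Complex.div_ofNat_re, Complex.add_re, Complex.inv_re, ← Complex.sq_norm, ← hsdef,
      this, ha]
    field_simp
  have him : ((v + v⁻¹) / 2).im = b * d := by
    have : v.im = s * d := by rw [hd]; field_simp
    simp only [Complex.div_ofNat_im, Complex.add_im, Complex.inv_im, ← Complex.sq_norm, ← hsdef,
      this, hb]
    field_simp
    ring
  have key : ∀ t : ℝ, (a * c - t) ^ 2 + (b * d) ^ 2 ≤ β ^ 2 →
      ‖(v + v⁻¹) / 2 - (t : ℂ)‖ ≤ β := by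
    intro t ht
    refine (sq_le_sq₀ (norm_nonneg _) hβ).mp ?_
    rw [Complex.sq_norm, Complex.normSq_apply]
    simp only [Complex.sub_re, Complex.sub_im, Complex.ofReal_re, Complex.ofReal_im, hre, him]
    nlinarith
  have hdb : b ^ 2 * d ^ 2 ≤ b ^ 2 := by nlinarith [sq_nonneg b, sq_nonneg c]
  have hc1 : c ^ 2 ≤ 1 := by nlinarith [sq_nonneg d]
  -- The nearest point of `[-1,1]` is the real part `a c`, clamped to the interval.
  by_cases hac1 : a * c ≤ 1
  · by_cases hac2 : -1 ≤ a * c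
    · refine ⟨a * c, ⟨hac2, hac1⟩, key _ ?_⟩
      nlinarith
    · refine ⟨-1, by norm_num, key _ ?_⟩
      have : (a * c - -1) ^ 2 + (b * d) ^ 2 = c ^ 2 + 2 * (a * c) + 1 + b ^ 2 := by
        have : d ^ 2 = 1 - c ^ 2 := by linarith
        linear_combination c ^ 2 * hab + b ^ 2 * this
      linarith
  · refine ⟨1, by norm_num, key _ ?_⟩
    have : (a * c - 1) ^ 2 + (b * d) ^ 2 = c ^ 2 - 2 * (a * c) + 1 + b ^ 2 := by
      have : d ^ 2 = 1 - c ^ 2 := by linarith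
      linear_combination c ^ 2 * hab + b ^ 2 * this
    linarith

/-- Integrals of `h(v)/v` over circles about the origin inside an annulus of holomorphy of `h`
do not depend on the radius, which bounds them by the values of `h` on any of these circles. -/
theorem norm_circleIntegral_inv_smul_le {h : ℂ → ℂ} {ρ R K : ℝ} (hρ : 1 ≤ ρ)
    (hR1 : ρ⁻¹ ≤ R) (hR2 : R ≤ ρ)
    (hd : ∀ v : ℂ, ρ⁻¹ ≤ ‖v‖ → ‖v‖ ≤ ρ → DifferentiableAt ℂ h v)
    (hK : ∀ v : ℂ, ‖v‖ = R → ‖h v‖ ≤ K) :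
    ‖∮ v in C(0, 1), v⁻¹ • h v‖ ≤ 2 * Real.pi * K := by
  have hρ0 : 0 < ρ := by linarith
  have hR0 : 0 < R := lt_of_lt_of_le (inv_pos.mpr hρ0) hR1
  have hρ1 : ρ⁻¹ ≤ 1 := inv_le_one_of_one_le₀ hρ
  have main : ∀ r₁ r₂ : ℝ, 0 < r₁ → r₁ ≤ r₂ → ρ⁻¹ ≤ r₁ → r₂ ≤ ρ →
      (∮ v in C(0, r₂), (v - 0)⁻¹ • h v) = ∮ v in C(0, r₁), (v - 0)⁻¹ • h v := by
    intro r₁ r₂ h0 h12 h1 h2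
    refine Complex.circleIntegral_sub_center_inv_smul_eq_of_differentiable_on_annulus_off_countable
      h0 h12 Set.countable_empty ?_ ?_
    · rintro v ⟨hv1, hv2⟩
      rw [mem_closedBall_zero_iff] at hv1
      rw [mem_ball_zero_iff, not_lt] at hv2
      exact (hd v (h1.trans hv2) (hv1.trans h2)).continuousAt.continuousWithinAt
    · rintro v ⟨⟨hv1, hv2⟩, -⟩
      rw [mem_ball_zero_iff] at hv1
      rw [mem_closedBall_zero_iff, not_le] at hv2
      exact hd v (h1.trans hv2.le) (hv1.le.trans h2)
  have heq : (∮ v in C(0, 1), v⁻¹ • h v) = ∮ v in C(0, R), v⁻¹ • h v := by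
    simp only [sub_zero] at main
    rcases le_total 1 R with h1 | h1
    · exact (main 1 R one_pos h1 hρ1 hR2).symm
    · exact main R 1 hR0 h1 hR1 hρ
  rw [heq]
  refine (circleIntegral.norm_integral_le_of_norm_le_const (C := R⁻¹ * K) hR0.le ?_).trans ?_
  · intro v hv
    rw [mem_sphere_zero_iff_norm] at hv
    rw [norm_smul, norm_inv, hv]
    exact mul_le_mul_of_nonneg_left (hK v hv) (by positivity)
  · rw [mul_assoc, ← mul_assoc R, mul_inv_cancel₀ hR0.ne', one_mul]

instance factTwoPiPos : Fact (0 < 2 * Real.pi) := ⟨Real.two_pi_pos⟩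

/-- The Chebyshev expansion of a function holomorphic and bounded near `[-1, 1]`. -/
theorem exists_chebyshev_expansion {β M : ℝ} (hβ : 0 < β) {g : ℂ → ℂ}
    (hd : ∀ z : ℂ, ∀ t ∈ Set.Icc (-1 : ℝ) 1, ‖z - (t : ℂ)‖ ≤ β → DifferentiableAt ℂ g z)
    (hM : ∀ z : ℂ, ∀ t ∈ Set.Icc (-1 : ℝ) 1, ‖z - (t : ℂ)‖ ≤ β → ‖g z‖ ≤ M) :
    ∃ a : ℤ → ℂ, (∀ k, ‖a k‖ ≤ M * (β + √(β ^ 2 + 1))⁻¹ ^ k.natAbs) ∧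
      ∀ x ∈ Set.Icc (-1 : ℝ) 1,
        HasSum (fun k : ℤ => a k * (((T ℝ k).eval x : ℝ) : ℂ)) (g x) := by
  set ρ := β + √(β ^ 2 + 1) with hρdef
  have hρ1 : 1 < ρ := by
    have : (1 : ℝ) ≤ √(β ^ 2 + 1) := by
      rw [Real.one_le_sqrt]; nlinarith [sq_nonneg β]
    linarith
  have hρ0 : 0 < ρ := by linarith
  set J : ℂ → ℂ := fun v => (v + v⁻¹) / 2 with hJ
  have hdJ : ∀ v : ℂ, ρ⁻¹ ≤ ‖v‖ → ‖v‖ ≤ ρ → DifferentiableAt ℂ (fun v => g (J v)) v := by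
    intro v h1 h2
    have hv : v ≠ 0 := by
      rintro rfl
      rw [norm_zero] at h1
      linarith [inv_pos.mpr hρ0]
    obtain ⟨t, ht, htv⟩ := exists_norm_joukowski_sub_le hβ.le h1 h2
    have : DifferentiableAt ℂ J v :=
      (differentiableAt_id.add (differentiableAt_id.inv hv)).div_const 2
    exact DifferentiableAt.comp v (hd _ t ht htv) this
  have hMJ : ∀ v : ℂ, ρ⁻¹ ≤ ‖v‖ → ‖v‖ ≤ ρ → ‖g (J v)‖ ≤ M := by
    intro v h1 h2
    obtain ⟨t, ht, htv⟩ := exists_norm_joukowski_sub_le hβ.le h1 h2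
    exact hM _ t ht htv
  have hinv1 : ρ⁻¹ ≤ 1 := inv_le_one_of_one_le₀ hρ1.le
  -- On the unit circle the Joukowski map is `cos θ`, so the Fourier series of `f` is the Chebyshev
  -- series of `g`.
  let f : C(AddCircle (2 * Real.pi), ℂ) :=
    ⟨fun x => g (J (AddCircle.toCircle x : ℂ)), by
      rw [continuous_iff_continuousAt]
      intro x
      have h1 := (hdJ (AddCircle.toCircle x : ℂ) (by rw [Circle.norm_coe]; exact hinv1)
        (by rw [Circle.norm_coe]; exact hρ1.le)).continuousAt
      have h2 : Continuous fun x : AddCircle (2 * Real.pi) => (AddCircle.toCircle x : ℂ) :=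
        continuous_subtype_val.comp AddCircle.continuous_toCircle
      exact ContinuousAt.comp (g := fun v => g (J v)) h1 h2.continuousAt⟩
  have hcircle : ∀ θ : ℝ, (AddCircle.toCircle (θ : AddCircle (2 * Real.pi)) : ℂ)
      = Complex.exp (θ * Complex.I) := by
    intro θ
    rw [AddCircle.toCircle_apply_mk, Circle.coe_exp]
    congr 2
    rw [div_self Real.two_pi_pos.ne', one_mul]
  have hf : ∀ θ : ℝ, f (θ : AddCircle (2 * Real.pi)) = g (J (Complex.exp (θ * Complex.I))) := by
    intro θ
    rw [← hcircle θ]; rfl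
  have hfourier : ∀ (k : ℤ) (θ : ℝ), fourier k (θ : AddCircle (2 * Real.pi))
      = Complex.exp (k * (θ * Complex.I)) := by
    intro k θ
    rw [fourier_coe_apply]
    congr 1
    have : (Real.pi : ℂ) ≠ 0 := by exact_mod_cast Real.pi_ne_zero
    push_cast
    field_simp
  have hcoeff : ∀ k : ℤ, fourierCoeff f k =
      (1 / (2 * Real.pi)) • (Complex.I⁻¹ * ∮ v in C(0, 1), v⁻¹ • (v ^ (-k) * g (J v))) := by
    intro k
    rw [fourierCoeff_eq_intervalIntegral f k 0, zero_add]
    congr 1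
    rw [circleIntegral, ← intervalIntegral.integral_const_mul]
    refine intervalIntegral.integral_congr fun θ _ => ?_
    simp only [deriv_circleMap, smul_eq_mul, hf, hfourier]
    have hc : circleMap 0 1 θ = Complex.exp (θ * Complex.I) := by simp [circleMap]
    have hne := Complex.exp_ne_zero (θ * Complex.I)
    rw [hc, ← Complex.exp_int_mul]
    field_simp [Complex.I_ne_zero]
  have hbound : ∀ (k : ℤ) (R : ℝ), ρ⁻¹ ≤ R → R ≤ ρ → ‖fourierCoeff f k‖ ≤ M * R ^ (-k) := by
    intro k R h1 h2
    have hR0 : 0 < R := lt_of_lt_of_le (inv_pos.mpr hρ0) h1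
    have := norm_circleIntegral_inv_smul_le (h := fun v => v ^ (-k) * g (J v)) (R := R)
      (K := M * R ^ (-k)) hρ1.le h1 h2 ?_ ?_
    · rw [hcoeff, norm_smul, norm_mul, norm_inv, Complex.norm_I, inv_one, one_mul,
        Real.norm_of_nonneg (by positivity)]
      calc 1 / (2 * Real.pi) * _ ≤ 1 / (2 * Real.pi) * (2 * Real.pi * (M * R ^ (-k))) :=
            mul_le_mul_of_nonneg_left this (by positivity)
        _ = _ := by field_simp
    · intro v hv1 hv2
      have hv : v ≠ 0 := by
        rintro rfl
        rw [norm_zero] at hv1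
        linarith [inv_pos.mpr hρ0]
      exact (differentiableAt_zpow.mpr (Or.inl hv)).mul (hdJ v hv1 hv2)
    · intro v hv
      rw [norm_mul, norm_zpow, hv, mul_comm]
      exact mul_le_mul_of_nonneg_right (hMJ v (by rw [hv]; exact h1) (by rw [hv]; exact h2))
        (by positivity)
  -- Shift the contour outwards to `ρ` for `k ≥ 0` and inwards to `ρ⁻¹` for `k ≤ 0`.
  have hdecay : ∀ k : ℤ, ‖fourierCoeff f k‖ ≤ M * ρ⁻¹ ^ k.natAbs := by
    intro k
    rcases Int.natAbs_eq k with hk | hk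
    · have := hbound k ρ (hinv1.trans hρ1.le) le_rfl
      rw [hk, zpow_neg, zpow_natCast, ← inv_pow] at this
      rw [hk, Int.natAbs_natCast]; exact this
    · have := hbound k ρ⁻¹ le_rfl (hinv1.trans hρ1.le)
      rw [hk, neg_neg, zpow_natCast] at this
      rw [hk, Int.natAbs_neg, Int.natAbs_natCast]; exact this
  have hgeom : Summable fun k : ℤ => M * ρ⁻¹ ^ k.natAbs := by
    refine Summable.mul_left M (Summable.of_nat_of_neg ?_ ?_) <;>
    · simp only [Int.natAbs_neg, Int.natAbs_natCast]
      exact summable_geometric_of_lt_one (by positivity) (inv_lt_one_of_one_lt₀ hρ1)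
  have hsum : Summable (fourierCoeff f) := Summable.of_norm_bounded hgeom hdecay
  refine ⟨fourierCoeff f, hdecay, ?_⟩
  intro x hx
  set θ := Real.arccos x with hθ
  have hxθ : x = Real.cos θ := (Real.cos_arccos hx.1 hx.2).symm
  have hJexp : ∀ φ : ℝ, J (Complex.exp (φ * Complex.I)) = (Real.cos φ : ℝ) := by
    intro φ
    simp only [hJ]
    rw [← Complex.exp_neg, Complex.ofReal_cos, Complex.cos, neg_mul]
  have s1 := has_pointwise_sum_fourier_series_of_summable hsum (θ : AddCircle (2 * Real.pi))
  have s2 := has_pointwise_sum_fourier_series_of_summable hsum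
    ((-θ : ℝ) : AddCircle (2 * Real.pi))
  rw [hf, hJexp] at s1 s2
  rw [Real.cos_neg] at s2
  rw [hxθ]
  -- Averaging the series at `θ` and `-θ` turns `exp(ikθ)` into `cos(kθ) = T_k(cos θ)`.
  have s3 := (s1.add s2).div_const 2
  rw [add_self_div_two] at s3
  refine s3.congr_fun ?_
  intro k
  rw [T_real_cos, hfourier, hfourier]
  push_cast
  rw [Complex.cos]
  simp only [smul_eq_mul]
  rw [show (k : ℂ) * (-(θ : ℂ) * Complex.I) = -(k * θ) * Complex.I by ring,
    show (k : ℂ) * ((θ : ℂ) * Complex.I) = (k * θ) * Complex.I by ring]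
  ring

end ChebyshevExpansion

/-! ### Univariate interpolation error. -/

section UnivariateError

theorem hasSum_geometric_tail {r : ℝ} (h0 : 0 ≤ r) (h1 : r < 1) (n : ℕ) :
    HasSum (fun k : ℕ => if k < n then 0 else r ^ k) (r ^ n * (1 - r)⁻¹) := by
  rw [← hasSum_nat_add_iff' n]
  have hz : ∑ i ∈ Finset.range n, (if i < n then (0 : ℝ) else r ^ i) = 0 :=
    Finset.sum_eq_zero fun i hi => if_pos (Finset.mem_range.mp hi)
  rw [hz, sub_zero]
  refine ((hasSum_geometric_of_lt_one h0 h1).mul_left (r ^ n)).congr_fun fun k => ?_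
  rw [if_neg (by omega), pow_add, mul_comm]

theorem hasSum_int_geometric_tail {r : ℝ} (h0 : 0 ≤ r) (h1 : r < 1) (m : ℕ) :
    HasSum (fun k : ℤ => if k.natAbs ≤ m then 0 else r ^ k.natAbs)
      (2 * (r ^ (m + 1) * (1 - r)⁻¹)) := by
  have hnat := hasSum_geometric_tail h0 h1 (m + 1)
  rw [two_mul]
  refine HasSum.of_nat_of_neg_add_one ?_ ?_
  · simpa only [Int.natAbs_natCast, Nat.lt_succ_iff] using hnat
  -- The negative integers start at `-1`; dropping the index `0` is free because its term is zero.
  · rw [← hasSum_nat_add_iff' 1] at hnat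
    simp only [Finset.range_one, Finset.sum_singleton, Nat.succ_pos, if_true, sub_zero] at hnat
    refine hnat.congr_fun fun k => ?_
    have : (-((k : ℤ) + 1)).natAbs = k + 1 := by omega
    rw [this]
    simp only [Nat.lt_succ_iff]

/-- Univariate Chebyshev interpolation of a function holomorphic and bounded near `[-1, 1]`. -/
theorem norm_sub_chebInterp_le {β M : ℝ} (hβ : 0 < β) {g : ℂ → ℂ}
    (hd : ∀ z : ℂ, ∀ t ∈ Set.Icc (-1 : ℝ) 1, ‖z - (t : ℂ)‖ ≤ β → DifferentiableAt ℂ g z)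
    (hM : ∀ z : ℂ, ∀ t ∈ Set.Icc (-1 : ℝ) 1, ‖z - (t : ℂ)‖ ≤ β → ‖g z‖ ≤ M)
    (m : ℕ) {x : ℝ} (hx : x ∈ Set.Icc (-1 : ℝ) 1) :
    ‖g x - ∑ i, g (chebNode m i) * (((chebLagrange m i).eval x : ℝ) : ℂ)‖ ≤
      2 * M * (lebesgueConst m + 1) / β * ((β + √(β ^ 2 + 1)) ^ m)⁻¹ := by
  obtain ⟨a, ha, hsum⟩ := exists_chebyshev_expansion hβ hd hM
  set ρ := β + √(β ^ 2 + 1) with hρdef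
  have hρβ : β ≤ ρ - 1 := by
    have : (1 : ℝ) ≤ √(β ^ 2 + 1) := by
      rw [Real.one_le_sqrt]; nlinarith [sq_nonneg β]
    linarith
  have hρ1 : 1 < ρ := by linarith
  have hM0 : 0 ≤ M := (norm_nonneg _).trans (hM 0 0 (by norm_num) (by simpa using hβ.le))
  have hΛ := one_le_lebesgueConst m
  have s1 := (hsum x hx).sub (hasSum_sum (s := Finset.univ) fun i (_ : i ∈ Finset.univ) =>
    (hsum _ (chebNode_mem_Icc m i)).mul_right (((chebLagrange m i).eval x : ℝ) : ℂ))
  have s2 := (hasSum_int_geometric_tail (inv_nonneg.mpr (by linarith : 0 ≤ ρ))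
    (inv_lt_one_of_one_lt₀ hρ1) m).mul_left (M * (lebesgueConst m + 1))
  -- Interpolate the series termwise: `T_k` is reproduced for `|k| ≤ m`, and otherwise its error is
  -- at most `Λ + 1`.
  refine (s1.norm_le_of_bounded s2 fun k => ?_).trans ?_
  · have hfac : a k * (((T ℝ k).eval x : ℝ) : ℂ) -
        ∑ i, a k * (((T ℝ k).eval (chebNode m i) : ℝ) : ℂ) *
          (((chebLagrange m i).eval x : ℝ) : ℂ) =
        a k * (((T ℝ k).eval x - ∑ i, (T ℝ k).eval (chebNode m i) *
          (chebLagrange m i).eval x : ℝ) : ℂ) := by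
      push_cast
      rw [mul_sub, Finset.mul_sum]
      simp only [mul_assoc]
    rw [hfac, norm_mul, Complex.norm_real, Real.norm_eq_abs]
    split_ifs with hk
    · rw [sum_eval_mul_chebLagrange m (P := T ℝ k) (by
        rw [degree_T]; exact_mod_cast Nat.lt_succ_iff.mpr hk), sub_self, abs_zero, mul_zero,
        mul_zero]
    · have hT : |(T ℝ k).eval x - ∑ i, (T ℝ k).eval (chebNode m i) * (chebLagrange m i).eval x|
          ≤ lebesgueConst m + 1 := by
        refine (abs_sub _ _).trans ?_
        rw [add_comm]
        refine add_le_add ?_ (abs_eval_T_real_le_one k (abs_le.mpr hx))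
        refine (Finset.abs_sum_le_sum_abs _ _).trans
          (le_trans (Finset.sum_le_sum fun i _ => ?_) (sum_abs_eval_chebLagrange_le m hx))
        rw [abs_mul]
        exact mul_le_of_le_one_left (abs_nonneg _)
          (abs_eval_T_real_le_one k (abs_le.mpr (chebNode_mem_Icc m i)))
      calc ‖a k‖ * _ ≤ (M * ρ⁻¹ ^ k.natAbs) * (lebesgueConst m + 1) :=
            mul_le_mul (ha k) hT (abs_nonneg _) (by positivity)
        _ = _ := by ring
  · have h1 : ρ⁻¹ ^ (m + 1) * (1 - ρ⁻¹)⁻¹ = (ρ ^ m)⁻¹ / (ρ - 1) := by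
      have : ρ - 1 ≠ 0 := by linarith
      have h0 : ρ ≠ 0 := by linarith
      have : 1 - ρ⁻¹ = (ρ - 1) / ρ := by field_simp
      rw [this, inv_div, pow_succ, inv_pow]
      field_simp
    rw [h1]
    calc M * (lebesgueConst m + 1) * (2 * ((ρ ^ m)⁻¹ / (ρ - 1)))
        ≤ M * (lebesgueConst m + 1) * (2 * ((ρ ^ m)⁻¹ / β)) := by gcongr
      _ = _ := by ring

end UnivariateError

/-! ### From one variable to tensor interpolation. -/

section TensorError

/-- The tensor interpolation operator on functions of `n` variables in `[-1, 1]`. -/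
noncomputable def cubeInterp (m n : ℕ) (h : (Fin n → ℝ) → ℂ) (u : Fin n → ℝ) : ℂ :=
  ∑ μ : Fin n → Fin (m + 1), h (fun l => chebNode m (μ l)) *
    ((∏ l, (chebLagrange m (μ l)).eval (u l) : ℝ) : ℂ)

/-- The sum of products of `|ℓ_i|` factors into `n` univariate Lebesgue sums. -/
theorem norm_cubeInterp_le (m n : ℕ) {h : (Fin n → ℝ) → ℂ} {K : ℝ}
    (hK : ∀ μ : Fin n → Fin (m + 1), ‖h fun l => chebNode m (μ l)‖ ≤ K) {u : Fin n → ℝ}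
    (hu : ∀ l, u l ∈ Set.Icc (-1 : ℝ) 1) :
    ‖cubeInterp m n h u‖ ≤ lebesgueConst m ^ n * K := by
  have hK0 : 0 ≤ K := (norm_nonneg _).trans (hK fun _ => 0)
  calc ‖cubeInterp m n h u‖
      ≤ ∑ μ : Fin n → Fin (m + 1), (∏ l, |(chebLagrange m (μ l)).eval (u l)|) * K := by
        refine norm_sum_le_of_le _ fun μ _ => ?_
        rw [norm_mul, Complex.norm_real, Real.norm_eq_abs, Finset.abs_prod, mul_comm]
        exact mul_le_mul_of_nonneg_left (hK μ) (by positivity)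
    _ = (∏ l, ∑ i, |(chebLagrange m i).eval (u l)|) * K := by
        rw [← Finset.sum_mul, Finset.prod_univ_sum, Fintype.piFinset_univ]
    _ ≤ lebesgueConst m ^ n * K := by
        refine mul_le_mul_of_nonneg_right ?_ hK0
        calc (∏ l, ∑ i, |(chebLagrange m i).eval (u l)|) ≤ ∏ _l : Fin n, lebesgueConst m :=
              Finset.prod_le_prod (fun l _ => by positivity)
                fun l _ => sum_abs_eval_chebLagrange_le m (hu l)
          _ = _ := by simp

theorem cubeInterp_succ (m n : ℕ) (h : (Fin (n + 1) → ℝ) → ℂ) (x : ℝ) (u : Fin n → ℝ) :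
    cubeInterp m (n + 1) h (Fin.cons x u) =
      cubeInterp m n (fun w => ∑ i, h (Fin.cons (chebNode m i) w) *
        (((chebLagrange m i).eval x : ℝ) : ℂ)) u := by
  unfold cubeInterp
  rw [← (Fin.consEquiv fun _ : Fin (n + 1) => Fin (m + 1)).sum_comp, Fintype.sum_prod_type,
    Finset.sum_comm]
  refine Finset.sum_congr rfl fun μ _ => ?_
  rw [Finset.sum_mul]
  refine Finset.sum_congr rfl fun i _ => ?_
  have : (fun l => chebNode m ((Fin.cons i μ : Fin (n + 1) → Fin (m + 1)) l)) =
      (Fin.cons (chebNode m i) fun l => chebNode m (μ l) : Fin (n + 1) → ℝ) := by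
    funext l
    refine Fin.cases ?_ (fun l => ?_) l <;> simp
  simp only [Fin.consEquiv_apply, this, Fin.prod_univ_succ, Fin.cons_zero, Fin.cons_succ]
  push_cast
  ring

/-- If interpolation in each single variable has error at most `ε`, tensor interpolation in `n`
variables has error at most `(1 + Λ + ⋯ + Λⁿ⁻¹) ε`. -/
theorem norm_sub_cubeInterp_le (m : ℕ) {ε : ℝ} (n : ℕ) (h : (Fin n → ℝ) → ℂ)
    (herr : ∀ u : Fin n → ℝ, (∀ l, u l ∈ Set.Icc (-1 : ℝ) 1) → ∀ j,
      ‖h u - ∑ i, h (Function.update u j (chebNode m i)) *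
        (((chebLagrange m i).eval (u j) : ℝ) : ℂ)‖ ≤ ε)
    {u : Fin n → ℝ} (hu : ∀ l, u l ∈ Set.Icc (-1 : ℝ) 1) :
    ‖h u - cubeInterp m n h u‖ ≤ (∑ k ∈ Finset.range n, lebesgueConst m ^ k) * ε := by
  induction n with
  | zero =>
    have : cubeInterp m 0 h u = h u := by
      simp only [cubeInterp, Finset.univ_unique, Finset.sum_singleton, Finset.univ_eq_empty,
        Finset.prod_empty, Complex.ofReal_one, mul_one]
      exact congrArg h (Subsingleton.elim _ _)
    simp [this]
  | succ n ih =>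
    obtain ⟨x, w, rfl⟩ : ∃ x w, u = Fin.cons x w := ⟨u 0, Fin.tail u, (Fin.cons_self_tail u).symm⟩
    have hx : x ∈ Set.Icc (-1 : ℝ) 1 := by simpa using hu 0
    have hw : ∀ l, w l ∈ Set.Icc (-1 : ℝ) 1 := fun l => by simpa using hu l.succ
    have hcons : ∀ (y : ℝ) (v : Fin n → ℝ), y ∈ Set.Icc (-1 : ℝ) 1 →
        (∀ l, v l ∈ Set.Icc (-1 : ℝ) 1) →
        ∀ l, (Fin.cons y v : Fin (n + 1) → ℝ) l ∈ Set.Icc (-1 : ℝ) 1 := by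
      intro y v hy hv l
      refine Fin.cases ?_ (fun l => ?_) l
      · simpa using hy
      · simpa using hv l
    have e1 : ‖h (Fin.cons x w) - cubeInterp m n (fun v => h (Fin.cons x v)) w‖ ≤
        (∑ k ∈ Finset.range n, lebesgueConst m ^ k) * ε := by
      refine ih (fun v => h (Fin.cons x v)) ?_ hw
      intro v hv j
      have := herr (Fin.cons x v) (hcons x v hx hv) j.succ
      simpa only [Fin.cons_update, Fin.cons_succ] using this
    -- The remaining difference is the `n`-variable interpolant of the univariate error in the first
    -- variable, so stability costs `Λⁿ`.
    have e2 : ‖cubeInterp m n (fun v => h (Fin.cons x v)) w -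
        cubeInterp m (n + 1) h (Fin.cons x w)‖ ≤ lebesgueConst m ^ n * ε := by
      have hsub : cubeInterp m n (fun v => h (Fin.cons x v)) w -
          cubeInterp m (n + 1) h (Fin.cons x w) =
          cubeInterp m n (fun v => h (Fin.cons x v) - ∑ i, h (Fin.cons (chebNode m i) v) *
            (((chebLagrange m i).eval x : ℝ) : ℂ)) w := by
        rw [cubeInterp_succ]
        simp only [cubeInterp, ← Finset.sum_sub_distrib, sub_mul]
      rw [hsub]
      refine norm_cubeInterp_le m n (fun μ => ?_) hw
      have := herr (Fin.cons x fun l => chebNode m (μ l))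
        (hcons _ _ hx fun l => chebNode_mem_Icc m _) 0
      simpa only [Fin.update_cons_zero, Fin.cons_zero] using this
    rw [Finset.sum_range_succ, add_mul]
    exact (norm_sub_le_norm_sub_add_norm_sub _ _ _).trans (add_le_add e1 e2)

/-- Tensor interpolation in two groups of `n` variables. -/
theorem norm_sub_cubeInterp_cubeInterp_le (m n : ℕ) {ε : ℝ}
    (h : (Fin n → ℝ) → (Fin n → ℝ) → ℂ)
    (herr₁ : ∀ u v : Fin n → ℝ, (∀ l, u l ∈ Set.Icc (-1 : ℝ) 1) →
      (∀ l, v l ∈ Set.Icc (-1 : ℝ) 1) → ∀ j,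
      ‖h u v - ∑ i, h (Function.update u j (chebNode m i)) v *
        (((chebLagrange m i).eval (u j) : ℝ) : ℂ)‖ ≤ ε)
    (herr₂ : ∀ u v : Fin n → ℝ, (∀ l, u l ∈ Set.Icc (-1 : ℝ) 1) →
      (∀ l, v l ∈ Set.Icc (-1 : ℝ) 1) → ∀ j,
      ‖h u v - ∑ i, h u (Function.update v j (chebNode m i)) *
        (((chebLagrange m i).eval (v j) : ℝ) : ℂ)‖ ≤ ε)
    {u v : Fin n → ℝ} (hu : ∀ l, u l ∈ Set.Icc (-1 : ℝ) 1)
    (hv : ∀ l, v l ∈ Set.Icc (-1 : ℝ) 1) :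
    ‖h u v - cubeInterp m n (fun u' => cubeInterp m n (h u') v) u‖ ≤
      (1 + lebesgueConst m ^ n) * (∑ k ∈ Finset.range n, lebesgueConst m ^ k) * ε := by
  have e1 : ‖h u v - cubeInterp m n (fun u' => h u' v) u‖ ≤
      (∑ k ∈ Finset.range n, lebesgueConst m ^ k) * ε :=
    norm_sub_cubeInterp_le m n (fun u' => h u' v) (fun u' hu' j => herr₁ u' v hu' hv j) hu
  have e2 : ‖cubeInterp m n (fun u' => h u' v) u -
      cubeInterp m n (fun u' => cubeInterp m n (h u') v) u‖ ≤
      lebesgueConst m ^ n * ((∑ k ∈ Finset.range n, lebesgueConst m ^ k) * ε) := by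
    have hsub : cubeInterp m n (fun u' => h u' v) u -
        cubeInterp m n (fun u' => cubeInterp m n (h u') v) u =
        cubeInterp m n (fun u' => h u' v - cubeInterp m n (h u') v) u := by
      unfold cubeInterp
      simp only [← Finset.sum_sub_distrib, sub_mul]
    rw [hsub]
    refine norm_cubeInterp_le m n (fun μ => ?_) hu
    exact norm_sub_cubeInterp_le m n (h fun l => chebNode m (μ l))
      (fun v' hv' j => herr₂ (fun l => chebNode m (μ l)) v' (fun l => chebNode_mem_Icc m _) hv' j)
      hv
  refine (norm_sub_le_norm_sub_add_norm_sub _ _ _).trans ((add_le_add e1 e2).trans (le_of_eq ?_))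
  ring

end TensorError

/-! ### The complexified Euclidean distance. -/

section ComplexNorm

theorem csqrt_sq (W : ℂ) : Complex.sqrt W ^ 2 = W := by
  simp [Complex.sqrt]

theorem csqrt_re_nonneg (W : ℂ) : 0 ≤ (Complex.sqrt W).re := by
  rw [Complex.sqrt, Complex.cpow_inv_two_re]
  exact Real.sqrt_nonneg _

theorem csqrt_ofReal_sq {a : ℝ} (ha : 0 ≤ a) : Complex.sqrt ((a : ℂ) ^ 2) = a := by
  have h : ((a : ℂ) ^ 2) = ((a ^ 2 : ℝ) : ℂ) := by push_cast; rfl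
  rw [h, Complex.sqrt, show (2⁻¹ : ℂ) = ((2⁻¹ : ℝ) : ℂ) by push_cast; rfl,
    ← Complex.ofReal_cpow (sq_nonneg a)]
  rw [← one_div, ← Real.sqrt_eq_rpow, Real.sqrt_sq ha]

/-- With `k = |Re κ|`, the left side falls short of the lower bound `r² - 2rk + 2k² - s²` of the
real part by `2 (s - k)(r - s - k) ≥ 0`. -/
theorem sq_sub_le_re_perturbed_sq {r b s : ℝ} {κ : ℂ} (hb : |b| ≤ r) (hκ : ‖κ‖ ≤ s)
    (hs : 2 * s ≤ r) : (r - s) ^ 2 ≤ ((r : ℂ) ^ 2 + 2 * (b : ℂ) * κ + κ ^ 2).re := by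
  have hre : ((r : ℂ) ^ 2 + 2 * (b : ℂ) * κ + κ ^ 2).re
      = r ^ 2 + 2 * b * κ.re + (κ.re ^ 2 - κ.im ^ 2) := by
    simp [sq, Complex.mul_re]
  have hn : κ.re ^ 2 + κ.im ^ 2 ≤ s ^ 2 := by
    have h := pow_le_pow_left₀ (norm_nonneg κ) hκ 2
    rw [Complex.sq_norm, Complex.normSq_apply] at h
    linarith
  have hk : |κ.re| ≤ s := (Complex.abs_re_le_norm κ).trans hκ
  have hbk : -(r * |κ.re|) ≤ b * κ.re := by
    have : |b * κ.re| ≤ r * |κ.re| := by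
      rw [abs_mul]
      exact mul_le_mul_of_nonneg_right hb (abs_nonneg _)
    exact (abs_le.mp this).1
  have hsq : |κ.re| ^ 2 = κ.re ^ 2 := sq_abs _
  rw [hre]
  have : 0 ≤ (s - |κ.re|) * (r - s - |κ.re|) :=
    mul_nonneg (by linarith) (by linarith)
  nlinarith

theorem sub_le_re_csqrt {r b s : ℝ} {κ : ℂ} (hb : |b| ≤ r) (hκ : ‖κ‖ ≤ s) (hs : 2 * s ≤ r) :
    r - s ≤ (Complex.sqrt ((r : ℂ) ^ 2 + 2 * (b : ℂ) * κ + κ ^ 2)).re := by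
  have h1 := sq_sub_le_re_perturbed_sq hb hκ hs
  set W := (r : ℂ) ^ 2 + 2 * (b : ℂ) * κ + κ ^ 2 with hW
  have h2 : W.re = (Complex.sqrt W).re ^ 2 - (Complex.sqrt W).im ^ 2 := by
    conv_lhs => rw [← csqrt_sq W]
    simp [sq, Complex.mul_re]
  refine le_of_sq_le_sq ?_ (csqrt_re_nonneg W)
  nlinarith [sq_nonneg (Complex.sqrt W).im]

/-- First-order expansion of the root `N` at `r`, with explicit remainder from `2r (N - r - (b/r)κ)
= κ² - (N - r)²`. -/
theorem abs_im_csqrt_sub_le {r b s : ℝ} {κ : ℂ} (hr : 0 < r) (hb : |b| ≤ r) (hκ : ‖κ‖ ≤ s)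
    (hs : 4 * s ≤ r) :
    |(Complex.sqrt ((r : ℂ) ^ 2 + 2 * (b : ℂ) * κ + κ ^ 2)).im - b / r * κ.im| ≤
      27 / 20 * s ^ 2 / r := by
  have hs0 : 0 ≤ s := (norm_nonneg _).trans hκ
  have hre := sub_le_re_csqrt hb hκ (by linarith)
  have hsq := csqrt_sq ((r : ℂ) ^ 2 + 2 * (b : ℂ) * κ + κ ^ 2)
  set N := Complex.sqrt ((r : ℂ) ^ 2 + 2 * (b : ℂ) * κ + κ ^ 2) with hN
  have hplus : 2 * r - s ≤ ‖N + r‖ := by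
    refine le_trans ?_ (Complex.re_le_norm _)
    simp only [Complex.add_re, Complex.ofReal_re]
    linarith
  have hprod : ‖N - r‖ * ‖N + r‖ ≤ s * (2 * r + s) := by
    rw [← norm_mul]
    have : (N - r) * (N + r) = κ * (2 * (b : ℂ) + κ) := by linear_combination hsq
    rw [this, norm_mul]
    refine mul_le_mul hκ ((norm_add_le _ _).trans ?_) (norm_nonneg _) hs0
    refine add_le_add ?_ hκ
    rw [norm_mul, Complex.norm_real, Real.norm_eq_abs]
    simpa using hb
  -- `9/7` is the value of `(2r + s)/(2r - s)` at `s = r/4`; later `(1 + (9/7)²)/2 ≤ 27/20`.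
  have hminus : ‖N - r‖ ≤ 9 / 7 * s := by
    have h1 : ‖N - r‖ * (2 * r - s) ≤ s * (2 * r + s) :=
      (mul_le_mul_of_nonneg_left hplus (norm_nonneg _)).trans hprod
    have h2 : s * (2 * r + s) ≤ 9 / 7 * s * (2 * r - s) := by nlinarith
    exact le_of_mul_le_mul_right (h1.trans h2) (by linarith)
  have hid : 2 * (r : ℂ) * (N - r - (b / r : ℝ) * κ) = κ ^ 2 - (N - r) ^ 2 := by
    have : (r : ℂ) ≠ 0 := by exact_mod_cast hr.ne'
    push_cast
    field_simp
    linear_combination hsq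
  have hnorm : 2 * r * ‖N - r - (b / r : ℝ) * κ‖ ≤ s ^ 2 + (9 / 7 * s) ^ 2 := by
    have h := congrArg norm hid
    rw [norm_mul, norm_mul, Complex.norm_real, Real.norm_of_nonneg hr.le] at h
    simp only [Complex.norm_ofNat] at h
    rw [h]
    refine (norm_sub_le _ _).trans ?_
    rw [norm_pow, norm_pow]
    exact add_le_add (pow_le_pow_left₀ (norm_nonneg _) hκ 2)
      (pow_le_pow_left₀ (norm_nonneg _) hminus 2)
  have him : (N - r - (b / r : ℝ) * κ).im = N.im - b / r * κ.im := by
    simp only [Complex.sub_im, Complex.ofReal_im, Complex.im_ofReal_mul, sub_zero]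
  rw [← him]
  refine (Complex.abs_im_le_norm _).trans ?_
  rw [le_div_iff₀ hr]
  nlinarith [sq_nonneg s]

/-- The squared distance of the directions is `(‖x - y‖² - (‖x‖ - ‖y‖)²) / (‖x‖ ‖y‖)`. -/
theorem norm_normalize_sub_normalize_le {x y : E3} {D q : ℝ} (hD : 0 < D) (hx : D ≤ ‖x‖)
    (hy : D ≤ ‖y‖) (hxy : ‖x - y‖ ≤ q) : ‖‖x‖⁻¹ • x - ‖y‖⁻¹ • y‖ ≤ q / D := by
  have hx0 : 0 < ‖x‖ := by linarith
  have hy0 : 0 < ‖y‖ := by linarith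
  have hq : 0 ≤ q := (norm_nonneg _).trans hxy
  refine le_of_sq_le_sq ?_ (by positivity)
  have e1 := @norm_sub_sq_real E3 _ _ (‖x‖⁻¹ • x) (‖y‖⁻¹ • y)
  have e2 := @norm_sub_sq_real E3 _ _ x y
  have n1 : ‖‖x‖⁻¹ • x‖ = 1 := by
    rw [norm_smul, norm_inv, norm_norm, inv_mul_cancel₀ hx0.ne']
  have n2 : ‖‖y‖⁻¹ • y‖ = 1 := by
    rw [norm_smul, norm_inv, norm_norm, inv_mul_cancel₀ hy0.ne']
  rw [n1, n2, real_inner_smul_left, real_inner_smul_right] at e1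
  have hsq : ‖x - y‖ ^ 2 ≤ q ^ 2 := pow_le_pow_left₀ (norm_nonneg _) hxy 2
  have hDD : D ^ 2 ≤ ‖x‖ * ‖y‖ := by nlinarith
  rw [e1, div_pow]
  have h3 : (1 : ℝ) ^ 2 - 2 * (‖x‖⁻¹ * (‖y‖⁻¹ * inner ℝ x y)) + 1 ^ 2
      = (2 * ‖x‖ * ‖y‖ - 2 * inner ℝ x y) / (‖x‖ * ‖y‖) := by
    field_simp
    ring
  rw [h3]
  refine div_le_div₀ (by positivity) ?_ (by positivity) hDD
  nlinarith [sq_nonneg (‖x‖ - ‖y‖)]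

end ComplexNorm

/-! ### Holomorphic extension of the remainder kernel and its bound. -/

section KernelExtension

/-- The remainder kernel along the complexified line `z + w p e_j`. -/
noncomputable def kernelExt (ζ : ℂ) (c z : E3) (j : Fin 3) (p : ℝ) (w : ℂ) : ℂ :=
  let N := Complex.sqrt ((‖z‖ : ℂ) ^ 2 + 2 * (z j : ℂ) * (p * w) + (p * w) ^ 2)
  Complex.exp (-(ζ.re : ℂ) * N) *
    (Complex.exp (-Complex.I * (ζ.im : ℂ) *
      (N - (((inner ℝ z c : ℝ) : ℂ) + (c j : ℂ) * (p * w)))) / (4 * (Real.pi : ℂ) * N))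

theorem norm_add_single_sq (z : E3) (j : Fin 3) (a : ℝ) :
    ‖z + EuclideanSpace.single j a‖ ^ 2 = ‖z‖ ^ 2 + 2 * z j * a + a ^ 2 := by
  rw [norm_add_sq_real, EuclideanSpace.inner_single_right, PiLp.norm_single]
  simp
  ring

theorem inner_add_single (z c : E3) (j : Fin 3) (a : ℝ) :
    (inner ℝ (z + EuclideanSpace.single j a) c : ℝ) = inner ℝ z c + c j * a := by
  rw [inner_add_left, EuclideanSpace.inner_single_left]
  simp
  ring

theorem kernelExt_zero (ζ : ℂ) (c z : E3) (j : Fin 3) (p : ℝ) :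
    kernelExt ζ c z j p 0 = Gc ζ c z := by
  simp only [kernelExt, Gc, mul_zero, zero_pow two_ne_zero, add_zero,
    csqrt_ofReal_sq (norm_nonneg z)]
  push_cast
  rfl

/-- Rebasing at a real point `t` of the line: the kernel bound, valid only for small perturbations,
then applies near all of `[-1,1]`. -/
theorem kernelExt_shift (ζ : ℂ) (c z : E3) (j : Fin 3) (p t : ℝ) (w : ℂ) :
    kernelExt ζ c (z + EuclideanSpace.single j (p * t)) j p (w - t) = kernelExt ζ c z j p w := by
  have h1 : ((‖z + EuclideanSpace.single j (p * t)‖ : ℂ)) ^ 2 =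
      (‖z‖ : ℂ) ^ 2 + 2 * (z j : ℂ) * (p * t) + (p * t) ^ 2 := by
    exact_mod_cast congrArg (fun a : ℝ => (a : ℂ)) (norm_add_single_sq z j (p * t))
  have h2 : (z + EuclideanSpace.single j (p * t)) j = z j + p * t := by simp
  have h3 : (‖z‖ : ℂ) ^ 2 + 2 * (z j : ℂ) * (p * t) + (p * t) ^ 2 +
      2 * ((z j + p * t : ℝ) : ℂ) * (p * (w - t)) + (p * (w - t)) ^ 2 =
      (‖z‖ : ℂ) ^ 2 + 2 * (z j : ℂ) * (p * w) + (p * w) ^ 2 := by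
    push_cast; ring
  have h4 : (((inner ℝ z c + c j * (p * t) : ℝ) : ℂ) + (c j : ℂ) * (p * (w - t))) =
      ((inner ℝ z c : ℝ) : ℂ) + (c j : ℂ) * (p * w) := by
    push_cast; ring
  simp only [kernelExt, h1, h2, inner_add_single, h3, h4]

theorem kernelExt_ofReal (ζ : ℂ) (c z : E3) (j : Fin 3) (p t : ℝ) :
    kernelExt ζ c z j p t = Gc ζ c (z + EuclideanSpace.single j (p * t)) := by
  rw [← kernelExt_shift ζ c z j p t t, sub_self, kernelExt_zero]

theorem betaHat_pos {η₂ η₃ : ℝ} (hη₂ : 0 < η₂) (hη₃' : η₃ < 1) : 0 < betaHat η₂ η₃ := by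
  refine lt_min one_pos (lt_min ?_ ?_)
  · refine mul_pos ?_ (by positivity)
    rw [sub_pos, Real.lt_sqrt zero_le_one]
    norm_num
  · have : 0 < 1 - η₃ := by linarith
    positivity

theorem betaHat_le_one (η₂ η₃ : ℝ) : betaHat η₂ η₃ ≤ 1 := min_le_left _ _

theorem betaHat_mul_le {η₂ : ℝ} (η₃ : ℝ) (hη₂ : 0 < η₂) : betaHat η₂ η₃ * η₂ ≤ 1 / 2 := by
  have h : betaHat η₂ η₃ ≤ (√(3 / 2) - 1) * (2 / η₂) :=
    (min_le_right _ _).trans (min_le_left _ _)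
  have hs : √(3 / 2) ≤ 5 / 4 := by
    rw [Real.sqrt_le_left (by norm_num)]; norm_num
  calc betaHat η₂ η₃ * η₂ ≤ (√(3 / 2) - 1) * (2 / η₂) * η₂ :=
        mul_le_mul_of_nonneg_right h hη₂.le
    _ = (√(3 / 2) - 1) * 2 := by field_simp
    _ ≤ 1 / 2 := by linarith

theorem betaHat_mul_sq_le {η₂ η₃ : ℝ} (hη₂ : 0 < η₂) (hη₃' : η₃ < 1) :
    betaHat η₂ η₃ * η₂ ^ 2 ≤ 3 / 10 * (1 - η₃) := by
  have h : betaHat η₂ η₃ ≤ 2 * (1 - η₃) / (η₂ ^ 2 * (2 * √6 + 5)) :=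
    (min_le_right _ _).trans (min_le_right _ _)
  have hs : 2 ≤ √6 := by
    rw [Real.le_sqrt' two_pos]; norm_num
  have h' : betaHat η₂ η₃ * (η₂ ^ 2 * (2 * √6 + 5)) ≤ 2 * (1 - η₃) := by
    rwa [le_div_iff₀ (by positivity)] at h
  have h0 := (betaHat_pos hη₂ hη₃').le
  have h9 : betaHat η₂ η₃ * η₂ ^ 2 * 9 ≤ betaHat η₂ η₃ * η₂ ^ 2 * (2 * √6 + 5) :=
    mul_le_mul_of_nonneg_left (by linarith) (by positivity)
  nlinarith

/-- Bound for the exponent of the extended kernel. Here `X` stands for `|Im ζ| q²`, `s` for the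
size of the complex perturbation, and `A` for the real part of the complex distance. -/
theorem exponent_le {η₁ η₂ η₃ β q D X s A B R : ℝ} (hη₁ : 0 < η₁)
    (hη₃ : 0 < η₃) (hη₃' : η₃ < 1) (hβ : 0 < β) (hβ1 : β ≤ 1) (hβ2 : β * η₂ ≤ 1 / 2)
    (hβ3 : β * η₂ ^ 2 ≤ 3 / 10 * (1 - η₃)) (hD : 0 < D) (hR : 0 < R) (hq : 0 ≤ q)
    (hs : s = β * q / 2) (hsing : q ≤ η₂ * D) (hX0 : 0 ≤ X)
    (hpara : X ≤ max η₂ (η₃ * R * D) * D) (hA : D - s ≤ A)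
    (hB : B ≤ (27 / 80 * β ^ 2 + β / 2) * (X / D) + β * η₁ / 2) :
    -R * A + B ≤ 1 + η₁ - (1 - η₃) / 2 * R * D := by
  have hsD : s ≤ D / 4 := by
    rw [hs]
    have : β * q ≤ β * (η₂ * D) := mul_le_mul_of_nonneg_left hsing hβ.le
    nlinarith
  have hRA : R * (D - s) ≤ R * A := mul_le_mul_of_nonneg_left hA hR.le
  have hXD : 0 ≤ X / D := by positivity
  have hB' : B ≤ 67 / 80 * (β * (X / D)) + η₁ := by
    have h1 : β ^ 2 ≤ β := by nlinarith
    have h2 : β ^ 2 * (X / D) ≤ β * (X / D) := mul_le_mul_of_nonneg_right h1 hXD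
    have h3 : β * η₁ ≤ η₁ := mul_le_of_le_one_left hη₁.le hβ1
    linarith
  have hXD' : X / D ≤ max η₂ (η₃ * R * D) := by rwa [div_le_iff₀ hD]
  have hRD : 0 < R * D := mul_pos hR hD
  -- If `η₂` is the maximum, the oscillation costs less than `1` and `s ≤ D/2` already leaves the
  -- decay `R D / 2`. Otherwise it costs up to `67/80 · η₃ R D`, and `s` needs the sharper bound
  -- below.
  rcases le_total (η₃ * R * D) η₂ with hc | hc
  · rw [max_eq_left hc] at hXD'
    have h1 : β * (X / D) ≤ 1 / 2 := (mul_le_mul_of_nonneg_left hXD' hβ.le).trans hβ2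
    have h2 : R * (D / 2) ≤ R * (D - s) := mul_le_mul_of_nonneg_left (by linarith) hR.le
    have h3 : 0 < η₃ * (R * D) := mul_pos hη₃ hRD
    nlinarith
  · rw [max_eq_right hc] at hXD'
    have h1 : β * (X / D) ≤ η₃ * R * D :=
      (mul_le_of_le_one_left hXD hβ1).trans hXD'
    -- Chosen to balance exactly: `1 - 13/80 - 27/80 (1 - η₃) - 67/80 η₃ = (1 - η₃)/2`.
    have h2 : s ≤ D * (13 / 80 + 27 / 80 * (1 - η₃)) := by
      refine le_of_sq_le_sq ?_ (mul_nonneg hD.le (by linarith))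
      have hq2 : q ^ 2 ≤ (η₂ * D) ^ 2 := pow_le_pow_left₀ hq hsing 2
      have h4 : β ^ 2 * q ^ 2 ≤ β * (3 / 10 * (1 - η₃)) * D ^ 2 := by
        calc β ^ 2 * q ^ 2 ≤ β ^ 2 * (η₂ * D) ^ 2 := mul_le_mul_of_nonneg_left hq2 (sq_nonneg β)
          _ = β * (β * η₂ ^ 2) * D ^ 2 := by ring
          _ ≤ _ := by gcongr
      have h5 : β * (3 / 10 * (1 - η₃)) * D ^ 2 ≤ 3 / 10 * (1 - η₃) * D ^ 2 := by
        have : 0 ≤ 3 / 10 * (1 - η₃) * D ^ 2 := by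
          have : 0 ≤ 1 - η₃ := by linarith
          positivity
        nlinarith
      have h6 : 3 / 40 * (1 - η₃) ≤ (13 / 80 + 27 / 80 * (1 - η₃)) ^ 2 := by
        nlinarith [sq_nonneg (13 / 80 - 27 / 80 * (1 - η₃))]
      have h7 := mul_le_mul_of_nonneg_right h6 (sq_nonneg D)
      rw [hs]
      nlinarith
    have h3 := mul_le_mul_of_nonneg_left h2 hR.le
    nlinarith

/-- Uniform bound for the extended kernel at complex perturbations of size at most `betaHat`. -/
theorem norm_kernelExt_le {η₁ η₂ η₃ : ℝ} (hη₁ : 0 < η₁) (hη₂ : 0 < η₂) (hη₃ : 0 < η₃)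
    (hη₃' : η₃ < 1) {ζ : ℂ} (hζ : 0 < ζ.re) {c z M : E3} {D q p : ℝ} (hD : 0 < D)
    (hz : D ≤ ‖z‖) (hM : D ≤ ‖M‖) (hzM : ‖z - M‖ ≤ q)
    (hangle : |ζ.im| * ‖‖M‖⁻¹ • M - c‖ * q ≤ η₁) (hsing : q ≤ η₂ * D)
    (hpara : |ζ.im| * q ^ 2 ≤ max η₂ (η₃ * ζ.re * D) * D) (hp : |p| ≤ q / 2) (j : Fin 3)
    {δ : ℂ} (hδ : ‖δ‖ ≤ betaHat η₂ η₃) :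
    DifferentiableAt ℂ (kernelExt ζ c z j p) δ ∧
    ‖kernelExt ζ c z j p δ‖ ≤
      4 * Real.exp η₁ * (Real.exp (-((1 - η₃) / 2) * ζ.re * D) / (4 * Real.pi * D)) := by
  have hβ := betaHat_pos hη₂ hη₃'
  have hβ1 := betaHat_le_one η₂ η₃
  have hβ2 := betaHat_mul_le η₃ hη₂
  have hβ3 := betaHat_mul_sq_le hη₂ hη₃'
  set β := betaHat η₂ η₃
  have hq : 0 ≤ q := (norm_nonneg _).trans hzM
  have hr : 0 < ‖z‖ := by linarith
  obtain ⟨s, hs⟩ : ∃ s, s = β * q / 2 := ⟨_, rfl⟩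
  have hs0 : 0 ≤ s := by rw [hs]; positivity
  have hκ : ‖(p : ℂ) * δ‖ ≤ s := by
    rw [norm_mul, Complex.norm_real, Real.norm_eq_abs, hs]
    calc |p| * ‖δ‖ ≤ q / 2 * β := mul_le_mul hp hδ (norm_nonneg _) (by positivity)
      _ = _ := by ring
  have hsD : 4 * s ≤ D := by
    rw [hs]
    have : β * q ≤ β * (η₂ * D) := mul_le_mul_of_nonneg_left hsing hβ.le
    nlinarith
  have hzj : |z j| ≤ ‖z‖ := by
    have := PiLp.norm_apply_le z j
    rwa [Real.norm_eq_abs] at this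
  have hWre := sq_sub_le_re_perturbed_sq hzj hκ (by linarith)
  have hNre := sub_le_re_csqrt hzj hκ (by linarith)
  have hNim := abs_im_csqrt_sub_le hr hzj hκ (by linarith)
  have hslit : (‖z‖ : ℂ) ^ 2 + 2 * (z j : ℂ) * (p * δ) + (p * δ) ^ 2 ∈ Complex.slitPlane := by
    refine Or.inl (lt_of_lt_of_le ?_ hWre)
    have : 0 < ‖z‖ - s := by linarith
    positivity
  have hN0 : Complex.sqrt ((‖z‖ : ℂ) ^ 2 + 2 * (z j : ℂ) * (p * δ) + (p * δ) ^ 2) ≠ 0 := by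
    intro h0
    rw [h0, Complex.zero_re] at hNre
    linarith
  have hpi : (Real.pi : ℂ) ≠ 0 := by exact_mod_cast Real.pi_ne_zero
  constructor
  · have hN : DifferentiableAt ℂ (fun w : ℂ => Complex.sqrt ((‖z‖ : ℂ) ^ 2 +
        2 * (z j : ℂ) * (p * w) + (p * w) ^ 2)) δ :=
      DifferentiableAt.comp δ (Complex.differentiableAt_sqrt hslit) (by fun_prop)
    unfold kernelExt
    refine DifferentiableAt.mul (hN.const_mul _).cexp (DifferentiableAt.div ?_
      (hN.const_mul _) (mul_ne_zero (mul_ne_zero (by norm_num) hpi) hN0))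
    refine DifferentiableAt.cexp (DifferentiableAt.const_mul (hN.sub ?_) _)
    fun_prop
  · set N := Complex.sqrt ((‖z‖ : ℂ) ^ 2 + 2 * (z j : ℂ) * (p * δ) + (p * δ) ^ 2) with hN
    have hnorm : ‖kernelExt ζ c z j p δ‖ = Real.exp (-ζ.re * N.re +
        ζ.im * (N.im - c j * ((p : ℂ) * δ).im)) / (4 * Real.pi * ‖N‖) := by
      change ‖Complex.exp (-(ζ.re : ℂ) * N) * (Complex.exp (-Complex.I * (ζ.im : ℂ) *
        (N - (((inner ℝ z c : ℝ) : ℂ) + (c j : ℂ) * (p * δ)))) / (4 * (Real.pi : ℂ) * N))‖ = _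
      rw [norm_mul, norm_div, Complex.norm_exp, Complex.norm_exp, norm_mul, norm_mul,
        Complex.norm_real, Real.norm_of_nonneg Real.pi_pos.le, Real.exp_add, mul_div_assoc]
      congr 2
      · simp
      · congr 1
        simp [Complex.mul_re, Complex.mul_im]
      · simp
    have hNnorm : 3 / 4 * D ≤ ‖N‖ := by
      refine le_trans ?_ (Complex.re_le_norm N)
      linarith
    -- Compare `z/‖z‖` with `c` through the direction `M/‖M‖`, the one the angle condition controls.
    have hdir : |z j / ‖z‖ - c j| ≤ q / D + ‖‖M‖⁻¹ • M - c‖ := by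
      have h1 := PiLp.norm_apply_le (‖z‖⁻¹ • z - c) j
      have h2 : (‖z‖⁻¹ • z - c) j = z j / ‖z‖ - c j := by
        simp [div_eq_inv_mul]
      rw [h2, Real.norm_eq_abs] at h1
      refine h1.trans ((norm_sub_le_norm_sub_add_norm_sub _ (‖M‖⁻¹ • M) _).trans ?_)
      exact add_le_add (norm_normalize_sub_normalize_le hD hz hM hzM) le_rfl
    have him : |N.im - c j * ((p : ℂ) * δ).im| ≤
        27 / 20 * s ^ 2 / D + (q / D + ‖‖M‖⁻¹ • M - c‖) * s := by
      have hsplit : N.im - c j * ((p : ℂ) * δ).im =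
          (N.im - z j / ‖z‖ * ((p : ℂ) * δ).im) + (z j / ‖z‖ - c j) * ((p : ℂ) * δ).im := by ring
      rw [hsplit]
      refine (abs_add_le _ _).trans (add_le_add (hNim.trans ?_) ?_)
      · gcongr
      · rw [abs_mul]
        exact mul_le_mul hdir ((Complex.abs_im_le_norm _).trans hκ) (abs_nonneg _)
          (by positivity)
    have hB : ζ.im * (N.im - c j * ((p : ℂ) * δ).im) ≤
        (27 / 80 * β ^ 2 + β / 2) * (|ζ.im| * q ^ 2 / D) + β * η₁ / 2 := by
      refine (le_abs_self _).trans ?_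
      rw [abs_mul]
      refine (mul_le_mul_of_nonneg_left him (abs_nonneg _)).trans ?_
      have h1 : |ζ.im| * (27 / 20 * s ^ 2 / D + (q / D + ‖‖M‖⁻¹ • M - c‖) * s) =
          (27 / 80 * β ^ 2 + β / 2) * (|ζ.im| * q ^ 2 / D) +
            β / 2 * (|ζ.im| * ‖‖M‖⁻¹ • M - c‖ * q) := by
        rw [hs]; field_simp; ring
      rw [h1]
      have := mul_le_mul_of_nonneg_left hangle (by positivity : 0 ≤ β / 2)
      linarith
    have hexp := exponent_le hη₁ hη₃ hη₃' hβ hβ1 hβ2 hβ3 hD hζ hq hs hsing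
      (by positivity) hpara (A := N.re) (by linarith) hB
    rw [hnorm]
    -- `3` bounds `e`; with `‖N‖ ≥ 3D/4` in the denominator it produces the factor `4`.
    have he : Real.exp (-ζ.re * N.re + ζ.im * (N.im - c j * ((p : ℂ) * δ).im)) ≤
        3 * (Real.exp η₁ * Real.exp (-((1 - η₃) / 2) * ζ.re * D)) := by
      refine (Real.exp_le_exp.mpr hexp).trans ?_
      rw [show 1 + η₁ - (1 - η₃) / 2 * ζ.re * D = 1 + (η₁ + -((1 - η₃) / 2) * ζ.re * D) by ring,
        Real.exp_add, Real.exp_add]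
      refine mul_le_mul_of_nonneg_right ?_ (by positivity)
      linarith [Real.exp_one_lt_d9]
    calc Real.exp (-ζ.re * N.re + ζ.im * (N.im - c j * ((p : ℂ) * δ).im)) / (4 * Real.pi * ‖N‖)
        ≤ 3 * (Real.exp η₁ * Real.exp (-((1 - η₃) / 2) * ζ.re * D)) /
          (4 * Real.pi * (3 / 4 * D)) := by gcongr
      _ = _ := by field_simp

end KernelExtension

/-! ### Boxes, their reference maps and distances. -/

section BoxGeometry

namespace Box

theorem norm_sub_center_le_half_norm (B : Box) {x : E3} (hx : x ∈ B.pts) :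
    ‖x - B.center‖ ≤ ‖B.hi - B.lo‖ / 2 := by
  have h2 : ‖B.hi - B.lo‖ / 2 = ‖(1 / 2 : ℝ) • (B.hi - B.lo)‖ := by
    rw [norm_smul]; norm_num; ring
  rw [h2, EuclideanSpace.norm_eq, EuclideanSpace.norm_eq]
  refine Real.sqrt_le_sqrt (Finset.sum_le_sum fun i _ => ?_)
  have := hx i
  have hc : (x - B.center) i = x i - (B.lo i + B.hi i) / 2 := by
    simp [center]; ring
  have hd : ((1 / 2 : ℝ) • (B.hi - B.lo)) i = (B.hi i - B.lo i) / 2 := by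
    simp; ring
  rw [hc, hd, Real.norm_eq_abs, Real.norm_eq_abs, sq_abs, sq_abs]
  nlinarith

theorem lo_mem_pts (B : Box) : B.lo ∈ B.pts := fun i => ⟨le_rfl, B.lo_le_hi i⟩

theorem hi_mem_pts (B : Box) : B.hi ∈ B.pts := fun i => ⟨B.lo_le_hi i, le_rfl⟩

theorem isBounded_pts (B : Box) : Bornology.IsBounded B.pts := by
  refine Metric.isBounded_closedBall.subset (s := B.pts)
    (t := Metric.closedBall B.center (‖B.hi - B.lo‖ / 2)) fun x hx => ?_
  rw [Metric.mem_closedBall, dist_eq_norm]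
  exact B.norm_sub_center_le_half_norm hx

theorem dist_le_diam (B : Box) {x y : E3} (hx : x ∈ B.pts) (hy : y ∈ B.pts) :
    dist x y ≤ B.diam := Metric.dist_le_diam_of_mem B.isBounded_pts hx hy

theorem norm_hi_sub_lo_le_diam (B : Box) : ‖B.hi - B.lo‖ ≤ B.diam := by
  rw [← dist_eq_norm]
  exact B.dist_le_diam B.hi_mem_pts B.lo_mem_pts

theorem diam_nonneg (B : Box) : 0 ≤ B.diam := Metric.diam_nonneg

theorem norm_sub_center_le (B : Box) {x : E3} (hx : x ∈ B.pts) :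
    ‖x - B.center‖ ≤ B.diam / 2 := by
  linarith [B.norm_sub_center_le_half_norm hx, B.norm_hi_sub_lo_le_diam]

theorem abs_half_side_le (B : Box) (j : Fin 3) : |(B.hi j - B.lo j) / 2| ≤ B.diam / 2 := by
  have h := PiLp.norm_apply_le (B.hi - B.lo) j
  rw [PiLp.sub_apply, Real.norm_eq_abs] at h
  rw [abs_div, abs_two]
  linarith [B.norm_hi_sub_lo_le_diam]

theorem center_apply (B : Box) (i : Fin 3) : B.center i = (B.lo i + B.hi i) / 2 := by
  simp [center]; ring

theorem center_mem_pts (B : Box) : B.center ∈ B.pts := by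
  intro i
  have := B.lo_le_hi i
  rw [center_apply]
  constructor <;> linarith

theorem theta_apply (B : Box) (u : E3) (i : Fin 3) :
    B.theta u i = B.center i + (B.hi i - B.lo i) / 2 * u i := rfl

theorem thetaInv_apply (B : Box) (x : E3) (i : Fin 3) :
    B.thetaInv x i = (x i - B.center i) / ((B.hi i - B.lo i) / 2) := rfl

theorem theta_mem_pts (B : Box) {u : E3} (hu : ∀ i, u i ∈ Set.Icc (-1 : ℝ) 1) :
    B.theta u ∈ B.pts := by
  intro i
  have h1 := B.lo_le_hi i
  have h2 := (hu i).1
  have h3 := (hu i).2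
  rw [theta_apply, center_apply]
  constructor <;> nlinarith

theorem thetaInv_mem_Icc (B : Box) {x : E3} (hx : x ∈ B.pts) (i : Fin 3) :
    B.thetaInv x i ∈ Set.Icc (-1 : ℝ) 1 := by
  have h1 := (hx i).1
  have h2 := (hx i).2
  rw [thetaInv_apply, center_apply]
  rcases (B.lo_le_hi i).eq_or_lt with h | h
  · simp [h]
  · have : 0 < (B.hi i - B.lo i) / 2 := by linarith
    constructor
    · rw [le_div_iff₀ this]; linarith
    · rw [div_le_iff₀ this]; linarith

theorem theta_thetaInv (B : Box) {x : E3} (hx : x ∈ B.pts) : B.theta (B.thetaInv x) = x := by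
  ext i
  have h1 := (hx i).1
  have h2 := (hx i).2
  rw [theta_apply, thetaInv_apply, center_apply]
  rcases (B.lo_le_hi i).eq_or_lt with h | h
  · rw [h, sub_self, zero_div, zero_mul]; linarith
  · have : B.hi i - B.lo i ≠ 0 := by linarith
    field_simp
    ring

theorem boxDist_le (A B : Box) {x y : E3} (hx : x ∈ A.pts) (hy : y ∈ B.pts) :
    boxDist A B ≤ ‖x - y‖ := by
  rw [← dist_eq_norm]
  refine csInf_le ⟨0, ?_⟩ (Set.mem_image2_of_mem hx hy)
  rintro _ ⟨a, _, b, _, rfl⟩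
  exact dist_nonneg

theorem boxDist_nonneg (A B : Box) : 0 ≤ boxDist A B := by
  refine Real.sInf_nonneg ?_
  rintro _ ⟨a, _, b, _, rfl⟩
  exact dist_nonneg

theorem theta_update (B : Box) (u : Fin 3 → ℝ) (j : Fin 3) (t : ℝ) :
    B.theta (WithLp.toLp 2 (Function.update u j t)) =
      B.theta (WithLp.toLp 2 (Function.update u j 0)) +
        EuclideanSpace.single j ((B.hi j - B.lo j) / 2 * t) := by
  ext i
  rw [PiLp.add_apply, theta_apply, theta_apply]
  rcases eq_or_ne i j with rfl | h
  · simp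
  · simp [h]

end Box

end BoxGeometry

/-! ### Interpolation of the remainder kernel on a pair of boxes. -/

section KernelInterpolation

theorem tensorInterp_eq_cubeInterp (m : ℕ) (Bt Bs : Box) (g : E3 → E3 → ℂ) (x y : E3) :
    tensorInterp m Bt Bs g x y =
      cubeInterp m 3 (fun u => cubeInterp m 3 (fun v => g (Bt.theta (WithLp.toLp 2 u))
        (Bs.theta (WithLp.toLp 2 v))) (Bs.thetaInv y)) (Bt.thetaInv x) := by
  unfold tensorInterp cubeInterp
  refine Finset.sum_congr rfl fun μ _ => ?_
  rw [Finset.sum_mul]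
  refine Finset.sum_congr rfl fun ν _ => ?_
  rw [boxLagrange, boxLagrange, boxNode, boxNode]
  ring

theorem planeWave_mul_Gc (ζ : ℂ) (c z : E3) : planeWave ζ c z * Gc ζ c z = G ζ z := by
  rw [planeWave, Gc, G, ← mul_assoc, ← mul_div_assoc, ← Complex.exp_add, ← Complex.exp_add]
  congr 2
  conv_rhs => rw [← Complex.re_add_im ζ]
  push_cast
  ring

theorem norm_planeWave (ζ : ℂ) (c z : E3) : ‖planeWave ζ c z‖ = 1 := by
  rw [planeWave, Complex.norm_exp]
  simp

theorem Gc_zero (ζ : ℂ) (c : E3) : Gc ζ c 0 = 0 := by simp [Gc]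

theorem G_zero (ζ : ℂ) : G ζ 0 = 0 := by simp [G]

/-- The bound for the univariate interpolation error of the remainder kernel. -/
noncomputable def lineErr (η₁ η₂ η₃ R D : ℝ) (m : ℕ) : ℝ :=
  2 * (4 * Real.exp η₁ * (Real.exp (-((1 - η₃) / 2) * R * D) / (4 * Real.pi * D))) *
    (lebesgueConst m + 1) / betaHat η₂ η₃ *
      ((betaHat η₂ η₃ + √(betaHat η₂ η₃ ^ 2 + 1)) ^ m)⁻¹

theorem norm_Gc_sub_lineInterp_le {η₁ η₂ η₃ : ℝ} (hη₁ : 0 < η₁) (hη₂ : 0 < η₂) (hη₃ : 0 < η₃)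
    (hη₃' : η₃ < 1) {ζ : ℂ} (hζ : 0 < ζ.re) {c z M : E3} {D q p : ℝ} (hD : 0 < D) (j : Fin 3)
    (hz : ∀ t ∈ Set.Icc (-1 : ℝ) 1, D ≤ ‖z + EuclideanSpace.single j (p * t)‖)
    (hM : D ≤ ‖M‖)
    (hzM : ∀ t ∈ Set.Icc (-1 : ℝ) 1, ‖z + EuclideanSpace.single j (p * t) - M‖ ≤ q)
    (hangle : |ζ.im| * ‖‖M‖⁻¹ • M - c‖ * q ≤ η₁) (hsing : q ≤ η₂ * D)
    (hpara : |ζ.im| * q ^ 2 ≤ max η₂ (η₃ * ζ.re * D) * D) (hp : |p| ≤ q / 2)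
    (m : ℕ) {t : ℝ} (ht : t ∈ Set.Icc (-1 : ℝ) 1) :
    ‖Gc ζ c (z + EuclideanSpace.single j (p * t)) -
      ∑ i, Gc ζ c (z + EuclideanSpace.single j (p * chebNode m i)) *
        (((chebLagrange m i).eval t : ℝ) : ℂ)‖ ≤ lineErr η₁ η₂ η₃ ζ.re D m := by
  have key : ∀ w : ℂ, ∀ t ∈ Set.Icc (-1 : ℝ) 1, ‖w - (t : ℂ)‖ ≤ betaHat η₂ η₃ →
      DifferentiableAt ℂ (kernelExt ζ c (z + EuclideanSpace.single j (p * t)) j p) (w - t) ∧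
      ‖kernelExt ζ c (z + EuclideanSpace.single j (p * t)) j p (w - t)‖ ≤
        4 * Real.exp η₁ * (Real.exp (-((1 - η₃) / 2) * ζ.re * D) / (4 * Real.pi * D)) :=
    fun w t ht hw => norm_kernelExt_le hη₁ hη₂ hη₃ hη₃' hζ hD (hz t ht) hM (hzM t ht) hangle hsing
      hpara hp j hw
  have := norm_sub_chebInterp_le (g := kernelExt ζ c z j p)
    (M := 4 * Real.exp η₁ * (Real.exp (-((1 - η₃) / 2) * ζ.re * D) / (4 * Real.pi * D)))
    (betaHat_pos hη₂ hη₃') (fun w t ht hw => ?_) (fun w t ht hw => ?_) m ht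
  · simpa only [kernelExt_ofReal, lineErr] using this
  · have h1 : kernelExt ζ c z j p =
        fun w => kernelExt ζ c (z + EuclideanSpace.single j (p * t)) j p (w - t) := by
      funext w
      rw [kernelExt_shift]
    rw [h1]
    exact DifferentiableAt.comp (f := fun w : ℂ => w - (t : ℂ)) w (key w t ht hw).1
      (differentiableAt_id.sub_const _)
  · rw [← kernelExt_shift ζ c z j p t w]
    exact (key w t ht hw).2

theorem norm_Gc_sub_tensorInterp_le {η₁ η₂ η₃ : ℝ} (hη₁ : 0 < η₁) (hη₂ : 0 < η₂)
    (hη₃ : 0 < η₃) (hη₃' : η₃ < 1) {ζ : ℂ} (hζ : 0 < ζ.re) {c : E3} {Bt Bs : Box}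
    (hadm : Admissible η₁ η₂ η₃ ζ c Bt Bs) (hD : 0 < Box.boxDist Bt Bs) (m : ℕ) {x y : E3}
    (hx : x ∈ Bt.pts) (hy : y ∈ Bs.pts) :
    ‖Gc ζ c (x - y) - tensorInterp m Bt Bs (fun u v => Gc ζ c (u - v)) x y‖ ≤
      6 * lebesgueConst m ^ 5 * lineErr η₁ η₂ η₃ ζ.re (Box.boxDist Bt Bs) m := by
  set D := Box.boxDist Bt Bs with hDdef
  set q := maxDiam Bt Bs with hq
  set M := Bt.center - Bs.center with hMdef
  have hqt : Bt.diam ≤ q := le_max_left _ _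
  have hqs : Bs.diam ≤ q := le_max_right _ _
  have hM : D ≤ ‖M‖ := Box.boxDist_le Bt Bs Bt.center_mem_pts Bs.center_mem_pts
  have hsep : ∀ a ∈ Bt.pts, ∀ b ∈ Bs.pts, D ≤ ‖a - b‖ := fun a ha b hb =>
    Box.boxDist_le Bt Bs ha hb
  -- Each point is within half a diameter of its centre, so the two deviations add up to at most
  -- `q`.
  have hclose : ∀ a ∈ Bt.pts, ∀ b ∈ Bs.pts, ‖a - b - M‖ ≤ q := by
    intro a ha b hb
    have h1 := Bt.norm_sub_center_le ha
    have h2 := Bs.norm_sub_center_le hb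
    have h3 : a - b - M = (a - Bt.center) - (b - Bs.center) := by rw [hMdef]; abel
    rw [h3]
    linarith [norm_sub_le (a - Bt.center) (b - Bs.center)]
  have hangle : |ζ.im| * ‖‖M‖⁻¹ • M - c‖ * q ≤ η₁ := hadm.angle
  have hsing : q ≤ η₂ * D := hadm.sing
  have hpara : |ζ.im| * q ^ 2 ≤ max η₂ (η₃ * ζ.re * D) * D := by
    refine le_trans (mul_le_mul_of_nonneg_left ?_ (abs_nonneg _)) hadm.para
    rw [hq, maxDiam]
    rcases max_choice Bt.diam Bs.diam with h | h <;> rw [h]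
    · exact le_max_left _ _
    · exact le_max_right _ _
  have hupd : ∀ (u : Fin 3 → ℝ), (∀ l, u l ∈ Set.Icc (-1 : ℝ) 1) → ∀ j,
      ∀ t ∈ Set.Icc (-1 : ℝ) 1, ∀ l, Function.update u j t l ∈ Set.Icc (-1 : ℝ) 1 := by
    intro u hu j t ht l
    rcases eq_or_ne l j with rfl | h
    · simpa using ht
    · simpa [h] using hu l
  have herr₁ : ∀ u v : Fin 3 → ℝ, (∀ l, u l ∈ Set.Icc (-1 : ℝ) 1) →
      (∀ l, v l ∈ Set.Icc (-1 : ℝ) 1) → ∀ j,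
      ‖Gc ζ c (Bt.theta (WithLp.toLp 2 u) - Bs.theta (WithLp.toLp 2 v)) -
        ∑ i, Gc ζ c (Bt.theta (WithLp.toLp 2 (Function.update u j (chebNode m i))) -
          Bs.theta (WithLp.toLp 2 v)) * (((chebLagrange m i).eval (u j) : ℝ) : ℂ)‖ ≤
        lineErr η₁ η₂ η₃ ζ.re D m := by
    intro u v hu hv j
    have hline : ∀ t : ℝ, Bt.theta (WithLp.toLp 2 (Function.update u j t)) -
        Bs.theta (WithLp.toLp 2 v) =
        (Bt.theta (WithLp.toLp 2 (Function.update u j 0)) - Bs.theta (WithLp.toLp 2 v)) +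
          EuclideanSpace.single j ((Bt.hi j - Bt.lo j) / 2 * t) := by
      intro t
      rw [Bt.theta_update u j t]
      abel
    have hmem : ∀ t ∈ Set.Icc (-1 : ℝ) 1,
        Bt.theta (WithLp.toLp 2 (Function.update u j t)) ∈ Bt.pts :=
      fun t ht => Bt.theta_mem_pts (hupd u hu j t ht)
    have hmem' : Bs.theta (WithLp.toLp 2 v) ∈ Bs.pts := Bs.theta_mem_pts hv
    have := norm_Gc_sub_lineInterp_le hη₁ hη₂ hη₃ hη₃' hζ hD j
      (z := Bt.theta (WithLp.toLp 2 (Function.update u j 0)) - Bs.theta (WithLp.toLp 2 v))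
      (p := (Bt.hi j - Bt.lo j) / 2)
      (fun t ht => by rw [← hline]; exact hsep _ (hmem t ht) _ hmem') hM
      (fun t ht => by rw [← hline]; exact hclose _ (hmem t ht) _ hmem') hangle hsing hpara
      ((Bt.abs_half_side_le j).trans (by linarith)) m (hu j)
    simpa only [← hline, Function.update_eq_self] using this
  have herr₂ : ∀ u v : Fin 3 → ℝ, (∀ l, u l ∈ Set.Icc (-1 : ℝ) 1) →
      (∀ l, v l ∈ Set.Icc (-1 : ℝ) 1) → ∀ j,
      ‖Gc ζ c (Bt.theta (WithLp.toLp 2 u) - Bs.theta (WithLp.toLp 2 v)) -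
        ∑ i, Gc ζ c (Bt.theta (WithLp.toLp 2 u) -
          Bs.theta (WithLp.toLp 2 (Function.update v j (chebNode m i)))) *
            (((chebLagrange m i).eval (v j) : ℝ) : ℂ)‖ ≤
        lineErr η₁ η₂ η₃ ζ.re D m := by
    intro u v hu hv j
    have hline : ∀ t : ℝ, Bt.theta (WithLp.toLp 2 u) -
        Bs.theta (WithLp.toLp 2 (Function.update v j t)) =
        (Bt.theta (WithLp.toLp 2 u) - Bs.theta (WithLp.toLp 2 (Function.update v j 0))) +
          EuclideanSpace.single j (-((Bs.hi j - Bs.lo j) / 2) * t) := by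
      intro t
      rw [Bs.theta_update v j t, neg_mul]
      ext i
      rcases eq_or_ne i j with rfl | h
      · simp; ring
      · simp [h]
    have hmem : ∀ t ∈ Set.Icc (-1 : ℝ) 1,
        Bs.theta (WithLp.toLp 2 (Function.update v j t)) ∈ Bs.pts :=
      fun t ht => Bs.theta_mem_pts (hupd v hv j t ht)
    have hmem' : Bt.theta (WithLp.toLp 2 u) ∈ Bt.pts := Bt.theta_mem_pts hu
    have := norm_Gc_sub_lineInterp_le hη₁ hη₂ hη₃ hη₃' hζ hD j
      (z := Bt.theta (WithLp.toLp 2 u) - Bs.theta (WithLp.toLp 2 (Function.update v j 0)))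
      -- The variable of `Bs` enters `x - y` with a minus sign, hence the negative half side.
      (p := -((Bs.hi j - Bs.lo j) / 2))
      (fun t ht => by rw [← hline]; exact hsep _ hmem' _ (hmem t ht)) hM
      (fun t ht => by rw [← hline]; exact hclose _ hmem' _ (hmem t ht)) hangle hsing hpara
      (by rw [abs_neg]; exact (Bs.abs_half_side_le j).trans (by linarith)) m (hv j)
    simpa only [← hline, Function.update_eq_self] using this
  have hmain := norm_sub_cubeInterp_cubeInterp_le m 3
    (fun u v => Gc ζ c (Bt.theta (WithLp.toLp 2 u) - Bs.theta (WithLp.toLp 2 v))) herr₁ herr₂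
    (Bt.thetaInv_mem_Icc hx) (Bs.thetaInv_mem_Icc hy)
  have hxy : Bt.theta (WithLp.toLp 2 (Bt.thetaInv x)) - Bs.theta (WithLp.toLp 2 (Bs.thetaInv y))
      = x - y := by
    rw [WithLp.toLp_ofLp, WithLp.toLp_ofLp, Bt.theta_thetaInv hx, Bs.theta_thetaInv hy]
  rw [tensorInterp_eq_cubeInterp]
  simp only [hxy] at hmain
  refine hmain.trans ?_
  have hε : 0 ≤ lineErr η₁ η₂ η₃ ζ.re D m :=
    (norm_nonneg _).trans (herr₁ (fun _ => 0) (fun _ => 0) (by simp) (by simp) 0)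
  refine mul_le_mul_of_nonneg_right ?_ hε
  have hΛ := one_le_lebesgueConst m
  simp only [Finset.sum_range_succ, Finset.sum_range_zero, pow_zero, pow_one, zero_add]
  have hp : ∀ k ≤ 5, lebesgueConst m ^ k ≤ lebesgueConst m ^ 5 := fun k hk =>
    pow_le_pow_right₀ hΛ hk
  have h0 := hp 0 (by norm_num)
  have h1 := hp 1 (by norm_num)
  have h2 := hp 2 (by norm_num)
  have h3 := hp 3 (by norm_num)
  have h4 := hp 4 (by norm_num)
  rw [pow_zero] at h0
  rw [pow_one] at h1
  calc (1 + lebesgueConst m ^ 3) * (1 + lebesgueConst m + lebesgueConst m ^ 2)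
      = 1 + lebesgueConst m + lebesgueConst m ^ 2 + lebesgueConst m ^ 3 + lebesgueConst m ^ 4 +
        lebesgueConst m ^ 5 := by ring
    _ ≤ _ := by linarith

/-- Two admissible boxes at distance zero are the same point; both kernels vanish there. -/
theorem G_sub_Gtilde_eq_zero {η₁ η₂ η₃ : ℝ} {ζ : ℂ} {c : E3} {Bt Bs : Box}
    (hadm : Admissible η₁ η₂ η₃ ζ c Bt Bs) (hD : Box.boxDist Bt Bs = 0) (m : ℕ) {x y : E3}
    (hx : x ∈ Bt.pts) (hy : y ∈ Bs.pts) : G ζ (x - y) - Gtilde ζ c m Bt Bs x y = 0 := by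
  have hq : maxDiam Bt Bs ≤ 0 := by simpa [hD] using hadm.sing
  have ht : ∀ a ∈ Bt.pts, a = x := fun a ha =>
    dist_le_zero.mp ((Bt.dist_le_diam ha hx).trans ((le_max_left _ _).trans hq))
  have hs : ∀ b ∈ Bs.pts, b = y := fun b hb =>
    dist_le_zero.mp ((Bs.dist_le_diam hb hy).trans ((le_max_right _ _).trans hq))
  have hxy : x = y := by
    refine dist_le_zero.mp ?_
    rw [← hD]
    refine le_csInf ⟨_, Set.mem_image2_of_mem hx hy⟩ ?_
    rintro _ ⟨a, ha, b, hb, rfl⟩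
    rw [ht a ha, hs b hb]
  have hnt : ∀ μ, boxNode m Bt μ = x := fun μ =>
    ht _ (Bt.theta_mem_pts fun l => chebNode_mem_Icc m (μ l))
  have hns : ∀ μ, boxNode m Bs μ = y := fun μ =>
    hs _ (Bs.theta_mem_pts fun l => chebNode_mem_Icc m (μ l))
  simp [Gtilde, tensorInterp, hnt, hns, hxy, G_zero, Gc_zero]

end KernelInterpolation

/-! ### Finiteness of the constants and absorption of the Lebesgue factors. -/

section Constants

theorem one_lt_rho0 {η₂ η₃ : ℝ} (hη₂ : 0 < η₂) (hη₃' : η₃ < 1) : 1 < rho0 η₂ η₃ := by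
  rw [rho0]
  linarith [betaHat_pos hη₂ hη₃']

theorem one_lt_alpha {η₂ η₃ : ℝ} (hη₂ : 0 < η₂) (hη₃' : η₃ < 1) : 1 < alpha η₂ η₃ := by
  have hβ := betaHat_pos hη₂ hη₃'
  rw [alpha, one_lt_div (by linarith), add_comm]
  have : 1 < √(betaHat η₂ η₃ ^ 2 + 1) := by
    rw [Real.lt_sqrt zero_le_one]
    nlinarith
  linarith

/-- The Bernstein rate exceeds the claimed rate `rho0` by the factor `alpha`, the reserve that pays
for all powers of `Λ`. -/
theorem rho0_mul_alpha {η₂ η₃ : ℝ} (hη₂ : 0 < η₂) (hη₃' : η₃ < 1) :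
    betaHat η₂ η₃ + √(betaHat η₂ η₃ ^ 2 + 1) = rho0 η₂ η₃ * alpha η₂ η₃ := by
  have hβ := betaHat_pos hη₂ hη₃'
  rw [rho0, alpha]
  field_simp
  ring

theorem exists_pow_le_mul_pow {γ : ℝ} (hγ : 1 < γ) (k : ℕ) :
    ∃ K : ℝ, ∀ m : ℕ, ((m : ℝ) + 1) ^ k / γ ^ m ≤ K := by
  obtain ⟨K, hK⟩ := (tendsto_pow_const_div_const_pow_of_one_lt k hγ).bddAbove_range
  refine ⟨K * γ, fun m => ?_⟩
  have h := hK ⟨m + 1, rfl⟩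
  have hγ0 : 0 < γ := by linarith
  simp only [Nat.cast_add, Nat.cast_one, pow_succ γ m] at h
  calc ((m : ℝ) + 1) ^ k / γ ^ m = ((m : ℝ) + 1) ^ k / (γ ^ m * γ) * γ := by field_simp
    _ ≤ K * γ := mul_le_mul_of_nonneg_right h hγ0.le

theorem rpow_half_eq_sqrt_pow {a : ℝ} (ha : 0 ≤ a) (m : ℕ) : a ^ ((m : ℝ) / 2) = √a ^ m := by
  rw [Real.sqrt_eq_rpow, ← Real.rpow_natCast, ← Real.rpow_mul ha]
  congr 1
  ring

theorem one_lt_sqrt_alpha {η₂ η₃ : ℝ} (hη₂ : 0 < η₂) (hη₃' : η₃ < 1) :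
    1 < √(alpha η₂ η₃) := by
  rw [Real.lt_sqrt zero_le_one, one_pow]
  exact one_lt_alpha hη₂ hη₃'

theorem bddAbove_C1seq {η₂ η₃ : ℝ} (hη₂ : 0 < η₂) (hη₃' : η₃ < 1) :
    BddAbove (Set.range (C1seq η₂ η₃)) := by
  have hα := one_lt_sqrt_alpha hη₂ hη₃'
  have hα0 : 0 ≤ alpha η₂ η₃ := by linarith [one_lt_alpha hη₂ hη₃']
  have hρ : 0 < rho0 η₂ η₃ - 1 := by linarith [one_lt_rho0 hη₂ hη₃']
  obtain ⟨K, hK⟩ := exists_pow_le_mul_pow hα 2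
  refine ⟨16 / (rho0 η₂ η₃ - 1) * K, ?_⟩
  rintro _ ⟨m, rfl⟩
  rw [C1seq, rpow_half_eq_sqrt_pow hα0]
  have hΛ : 8 * (lebesgueConst m + 1) ≤ 16 * ((m : ℝ) + 1) ^ 2 := by
    have h1 := lebesgueConst_le m
    have h2 : (1 : ℝ) ≤ ((m : ℝ) + 1) ^ 2 :=
      one_le_pow₀ (by linarith [(Nat.cast_nonneg m : (0 : ℝ) ≤ m)])
    linarith
  have hpow : 0 < √(alpha η₂ η₃) ^ m := by positivity
  calc 8 * (lebesgueConst m + 1) / ((rho0 η₂ η₃ - 1) * √(alpha η₂ η₃) ^ m)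
      ≤ 16 * ((m : ℝ) + 1) ^ 2 / ((rho0 η₂ η₃ - 1) * √(alpha η₂ η₃) ^ m) := by gcongr
    _ = 16 / (rho0 η₂ η₃ - 1) * (((m : ℝ) + 1) ^ 2 / √(alpha η₂ η₃) ^ m) := by
        rw [mul_div_mul_comm]
    _ ≤ _ := mul_le_mul_of_nonneg_left (hK m) (by positivity)

theorem C1_nonneg {η₂ η₃ : ℝ} (η₁ : ℝ) (hη₂ : 0 < η₂) (hη₃' : η₃ < 1) : 0 ≤ C1 η₁ η₂ η₃ := by
  refine mul_nonneg (Real.exp_pos _).le (Real.iSup_nonneg fun m => ?_)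
  have hα0 : 0 ≤ alpha η₂ η₃ := by linarith [one_lt_alpha hη₂ hη₃']
  have hρ : 0 < rho0 η₂ η₃ - 1 := by linarith [one_lt_rho0 hη₂ hη₃']
  have hΛ := one_le_lebesgueConst m
  rw [C1seq]
  positivity

theorem bddAbove_C0seq {η₂ η₃ : ℝ} (η₁ : ℝ) (hη₂ : 0 < η₂) (hη₃' : η₃ < 1) :
    BddAbove (Set.range (C0seq η₁ η₂ η₃)) := by
  have hα := one_lt_sqrt_alpha hη₂ hη₃'
  have hα0 : 0 ≤ alpha η₂ η₃ := by linarith [one_lt_alpha hη₂ hη₃']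
  have hC1 := C1_nonneg η₁ hη₂ hη₃'
  obtain ⟨K, hK⟩ := exists_pow_le_mul_pow hα 10
  refine ⟨6 * K * C1 η₁ η₂ η₃, ?_⟩
  rintro _ ⟨m, rfl⟩
  rw [C0seq, rpow_half_eq_sqrt_pow hα0]
  have hΛ0 := one_le_lebesgueConst m
  have hΛ : lebesgueConst m ^ 5 ≤ ((m : ℝ) + 1) ^ 10 := by
    have := pow_le_pow_left₀ (by linarith) (lebesgueConst_le m) 5
    rwa [← pow_mul] at this
  have hpow : 0 < √(alpha η₂ η₃) ^ m := by positivity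
  have : lebesgueConst m ^ 5 / √(alpha η₂ η₃) ^ m ≤ K :=
    (div_le_div_of_nonneg_right hΛ hpow.le).trans (hK m)
  gcongr

/-- The accumulated interpolation error is absorbed by the constant `C0`. -/
theorem mul_lineErr_le {η₁ η₂ η₃ : ℝ} (hη₂ : 0 < η₂) (hη₃' : η₃ < 1) {R D : ℝ}
    (hD : 0 < D) (m : ℕ) :
    6 * lebesgueConst m ^ 5 * lineErr η₁ η₂ η₃ R D m ≤
      C0 η₁ η₂ η₃ * Real.exp (-((1 - η₃) / 2) * R * D) / (4 * Real.pi * D) *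
        (rho0 η₂ η₃ ^ m)⁻¹ := by
  have hα := one_lt_alpha hη₂ hη₃'
  have hα0 : 0 ≤ alpha η₂ η₃ := by linarith
  have hρ := one_lt_rho0 hη₂ hη₃'
  have hβ := betaHat_pos hη₂ hη₃'
  have hΛ := one_le_lebesgueConst m
  have hC1 : Real.exp η₁ * C1seq η₂ η₃ m ≤ C1 η₁ η₂ η₃ :=
    mul_le_mul_of_nonneg_left (le_ciSup (bddAbove_C1seq hη₂ hη₃') m) (Real.exp_pos _).le
  have hC0 : C0seq η₁ η₂ η₃ m ≤ C0 η₁ η₂ η₃ := le_ciSup (bddAbove_C0seq η₁ hη₂ hη₃') m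
  have hρ1 : rho0 η₂ η₃ - 1 = betaHat η₂ η₃ := by rw [rho0]; ring
  rw [C1seq, hρ1] at hC1
  rw [C0seq] at hC0
  set a := alpha η₂ η₃ ^ ((m : ℝ) / 2) with ha
  have ha0 : 0 < a := Real.rpow_pos_of_pos (by linarith) _
  -- One factor `a` goes with `Λ + 1` into `C1`, the other with `Λ⁵` into `C0`; the `8` in `C1seq`
  -- is `2 · 4`, from the two-sided tail and the kernel bound.
  have haa : alpha η₂ η₃ ^ m = a * a := by
    rw [ha, rpow_half_eq_sqrt_pow hα0, ← mul_pow, Real.mul_self_sqrt hα0]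
  rw [lineErr, rho0_mul_alpha hη₂ hη₃', mul_pow, haa]
  set E := Real.exp (-((1 - η₃) / 2) * R * D)
  have hE : 0 < E := Real.exp_pos _
  calc 6 * lebesgueConst m ^ 5 * (2 * (4 * Real.exp η₁ * (E / (4 * Real.pi * D))) *
        (lebesgueConst m + 1) / betaHat η₂ η₃ * (rho0 η₂ η₃ ^ m * (a * a))⁻¹)
      = 6 * (lebesgueConst m ^ 5 / a) *
          (Real.exp η₁ * (8 * (lebesgueConst m + 1) / (betaHat η₂ η₃ * a))) *
            (E / (4 * Real.pi * D) * (rho0 η₂ η₃ ^ m)⁻¹) := by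
        field_simp
        ring
    _ ≤ 6 * (lebesgueConst m ^ 5 / a) * C1 η₁ η₂ η₃ *
          (E / (4 * Real.pi * D) * (rho0 η₂ η₃ ^ m)⁻¹) := by gcongr
    _ ≤ C0 η₁ η₂ η₃ * (E / (4 * Real.pi * D) * (rho0 η₂ η₃ ^ m)⁻¹) := by gcongr
    _ = _ := by ring

end Constants

end DirInterp

theorem mainTheorem1 (η₁ η₂ η₃ : ℝ) (hη₁ : 0 < η₁) (hη₂ : 0 < η₂) (hη₃ : 0 < η₃)
    (hη₃' : η₃ < 1) :
    1 < rho0 η₂ η₃ ∧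
    BddAbove (Set.range (C1seq η₂ η₃)) ∧
    BddAbove (Set.range (C0seq η₁ η₂ η₃)) ∧
    ∀ (ζ : ℂ), 0 < ζ.re → ∀ (c : E3) (Bt Bs : Box), Admissible η₁ η₂ η₃ ζ c Bt Bs →
      ∀ (m : ℕ), ∀ x ∈ Bt.pts, ∀ y ∈ Bs.pts,
        ‖G ζ (x - y) - Gtilde ζ c m Bt Bs x y‖ ≤
          C0 η₁ η₂ η₃ * Real.exp (-((1 - η₃) / 2) * ζ.re * Box.boxDist Bt Bs) /
            (4 * Real.pi * Box.boxDist Bt Bs) * (rho0 η₂ η₃ ^ m)⁻¹ := by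

  refine ⟨one_lt_rho0 hη₂ hη₃', bddAbove_C1seq hη₂ hη₃', bddAbove_C0seq η₁ hη₂ hη₃', ?_⟩
  intro ζ hζ c Bt Bs hadm m x hx y hy
  rcases (Box.boxDist_nonneg Bt Bs).eq_or_lt with hD | hD
  -- At distance zero the right-hand side is also zero, by division by zero.
  · rw [G_sub_Gtilde_eq_zero hadm hD.symm m hx hy, norm_zero, ← hD]
    simp
  · rw [Gtilde, ← planeWave_mul_Gc ζ c, ← mul_sub, norm_mul, norm_planeWave, one_mul]
    exact (norm_Gc_sub_tensorInterp_le hη₁ hη₂ hη₃ hη₃' hζ hadm hD m hx hy).trans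
      (mul_lineErr_le hη₂ hη₃' hD m)
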